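/- **Models.** Fix an integer $\kappa\ge 2$; a machine word on $n$-node inputs consists of $\kappa\cdot(\lfloor\log_2 n\rfloor+1)=\Theta(\log n)$ bits. Computation is synchronous and deterministic, and in each round a machine receives the messages (words) sent to it in the previous round, updates its state and sends new messages to arbitrary machines. * In $\mathrm{NCC}(C)$ the $n$ machines are the nodes of the input graph. Each node knows all node identifiers and initially its own neighbours (and the input labels at itself and at its incident edges). In each round each node sends at most $C$ and receives at most $C$ words. Local memory and local computation are unrestricted. * In $\mathrm{MPC}(M,S)$ there are $M$ machines, which run the same computable program and know $n,M,S$ and the arboricity parameter $a(n)$. The edges of the input graph (with their labels) are distributed over the machines adversarially, at most $S$ words per machine. In each round the local state of a machine together with its received messages occupies at most $S$ words, and each machine sends at most $S$ words. An algorithm that violates these bounds on some input is not admissible. A graph problem assigns to each input in a given set of (labelled) graphs with node identifiers $0,\dots,n-1$ a set of legal outputs of size polynomial in $n$. An algorithm solves it in $T(n)$ rounds if, for every input and every input distribution, after $T(n)$ rounds the pieces of output reported by the machines together form one legal output $s$, with total length $O(|s|)$. For a family $\mathcal P$ of graph problems, $\mathrm{MPC}(M,S)\le_{\mathcal P}\mathrm{NCC}(C)$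 means that every problem in $\mathcal P$ that can be solved in $T(n)\ge 1$ rounds in $\mathrm{MPC}(M,S)$ can be solved in $O(T(n))$ rounds in $\mathrm{NCC}(C)$. The arboricity of a graph is the least $k$ such that its edge set is the union of $k$ edge-disjoint forests. **Theorem.** There are constants $K,c>0$ (depending only on $\kappa$) such that the following holds. Let $a:\mathbb N\to\mathbb N$ with $a\in\omega(\log n)\cap o(n^{1/3})$, and let $\mathcal P_a$ be the family of graph problems whose $n$-node input graphs have arboricity $a(n)$. Let $\delta\in(0,1)$ and let $M,S:\mathbb N\to\mathbb N$ satisfy, for all large $n$, $S\ge n^{\delta}$ and $MS\ge 2n$, and moreover $\frac{MS}{n}\in o\!\left(\frac{a}{\log n}\right)$ (for instance $S=\lceil n^\delta\rceil$ and $MS=\Theta(n)$ with $MS\ge 2n$). Then $$\mathrm{MPC}(M,S)\not\le_{\mathcal P_a}\mathrm{NCC}\!\left(\left\lceil\tfrac{MS}{n}\right\rceil\right).$$ More precisely, there is a class $\mathcal G$ of connected graphs whose $n$-node members have arboricity $a(n)$, such that the problem of listing all triangles of a graph from $\mathcal G$ (each triangle has to be reported by at least one machine) 1. can be solved in $\mathrm{MPC}(M,S)$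 in at most $K/\delta$ rounds, and 2. for all sufficiently large $n$ and all $C$, cannot be solved on the $n$-node graphs of $\mathcal G$ in $\mathrm{NCC}(C)$ in fewer than $c\cdot\frac{a(n)}{C\log n}$ rounds. In particular, for $MS=\Theta(n)$ the problem takes $O(1/\delta)$ rounds in $\mathrm{MPC}(M,S)$ and $\Omega(a/\log n)$ rounds in $\mathrm{NCC}(O(1))$. -/

import Mathlib

open Filter Asymptotics

/-! ### Graphs, words, graph problems -/

/-- The arboricity of `G`: the least `k` such that the edge set of `G` is the union of `k`
edge-disjoint forests. -/
noncomputable def arboricity {V : Type} (G : SimpleGraph V) : ℕ :=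
  sInf {k : ℕ | ∃ F : Fin k → SimpleGraph V,
    (∀ i, (F i).IsAcyclic) ∧ Pairwise (fun i j => Disjoint (F i) (F j)) ∧ G = ⨆ i, F i}

/-- A machine word has `κ * Nat.size n` bits, i.e. `Θ(log n)` bits; it is a natural number below
`wordBound κ n`. A word can carry `κ` identifiers. -/
def wordBound (κ n : ℕ) : ℕ := 2 ^ (κ * Nat.size n)

/-- An input on `n` nodes: a graph whose nodes have the identifiers `0, …, n-1`, with `ℓ` label
words on every node and on every edge. -/
structure GraphInput (n ℓ : ℕ) where
  graph : SimpleGraph (Fin n)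
  nodeLabel : Fin n → Fin ℓ → ℕ
  edgeLabel : Sym2 (Fin n) → Fin ℓ → ℕ

/-- A piece of output is a tuple of words (such as a node together with its colour, or the three
corners of a triangle). -/
abbrev OutItem := List ℕ

/-- A graph problem: a set of inputs, and for each input a set of legal outputs. An output is a
finite set of output items. Labels and outputs consist of machine words, and the size of a
legal output, in words, is at most `n ^ outExp`. -/
structure GraphProblem (κ : ℕ) where
  labelWords : ℕ
  inputs : (n : ℕ) → Set (GraphInput n labelWords)
  legal : {n : ℕ} → GraphInput n labelWords → Set (Finset OutItem)
  outExp : ℕ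
  nodeLabel_lt : ∀ n, ∀ I ∈ inputs n, ∀ v i, I.nodeLabel v i < wordBound κ n
  edgeLabel_lt : ∀ n, ∀ I ∈ inputs n, ∀ e i, I.edgeLabel e i < wordBound κ n
  out_lt : ∀ n, ∀ I ∈ inputs n, ∀ s ∈ legal I, ∀ x ∈ s, ∀ w ∈ x, w < wordBound κ n
  out_size : ∀ n, ∀ I ∈ inputs n, ∀ s ∈ legal I, ∑ x ∈ s, x.length ≤ n ^ outExp

/-- The outputs `out i` of the individual machines represent a legal output `s`: each item of `s`
is reported by at least one machine, nothing else is reported, and the total length of what is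
reported is at most `β` times the size of `s`. -/
def RepresentsLegal {m : ℕ} (β : ℕ) (legal : Set (Finset OutItem))
    (out : Fin m → List OutItem) : Prop :=
  ∃ s ∈ legal, (∀ x, x ∈ s ↔ ∃ i, x ∈ out i) ∧
    ∑ i, ((out i).map List.length).sum ≤ β * ∑ x ∈ s, x.length

/-- The family `P_a` of the graph problems whose input graphs on `n` nodes have
arboricity `a n`. -/
def problemsOfArboricity (κ : ℕ) (a : ℕ → ℕ) : Set (GraphProblem κ) :=
  {P | ∀ n, ∀ I ∈ P.inputs n, arboricity I.graph = a n}

/-! ### Synchronous message passing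

There are `m` machines, numbered `0, …, m-1`. A message is a pair of a machine and a word: in an
outbox the machine is the receiver, in an inbox it is the sender. -/

/-- The inbox of machine `i`, given the outboxes of all machines. -/
def deliver {m : ℕ} (outbox : Fin m → List (ℕ × ℕ)) (i : Fin m) : List (ℕ × ℕ) :=
  (List.finRange m).flatMap fun j =>
    ((outbox j).filter fun msg => msg.1 = (i : ℕ)).map fun msg => ((j : ℕ), msg.2)

/-- The local states and the inboxes after `r` rounds. In round `r` machine `i` turns its state
and its inbox into a new state and an outbox, by `step i r`; the messages sent are received
at the start of the next round. -/
def runNetwork {m : ℕ} {σ : Type}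
    (step : Fin m → ℕ → σ → List (ℕ × ℕ) → σ × List (ℕ × ℕ)) (init : Fin m → σ) :
    ℕ → Fin m → σ × List (ℕ × ℕ)
  | 0 => fun i => (init i, [])
  | r + 1 => fun i =>
      let prev := runNetwork step init r
      let res := fun j => step j r (prev j).1 (prev j).2
      ((res i).1, deliver (fun j => (res j).2) i)

/-- The outbox of machine `i` in round `r`. -/
def sentInRound {m : ℕ} {σ : Type}
    (step : Fin m → ℕ → σ → List (ℕ × ℕ) → σ × List (ℕ × ℕ)) (init : Fin m → σ)
    (r : ℕ) (i : Fin m) : List (ℕ × ℕ) :=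
  (step i r (runNetwork step init r i).1 (runNetwork step init r i).2).2

/-! ### The node-capacitated clique -/

/-- What a node of the node-capacitated clique knows of the input at the start: its neighbours,
its own label and the labels of its incident edges. -/
structure NodeInput (n ℓ : ℕ) where
  neighbours : Set (Fin n)
  label : Fin ℓ → ℕ
  edgeLabel : neighbours → Fin ℓ → ℕ

/-- The initial knowledge of the node `v`. -/
def GraphInput.atNode {n ℓ : ℕ} (I : GraphInput n ℓ) (v : Fin n) : NodeInput n ℓ where
  neighbours := I.graph.neighborSet v
  label := I.nodeLabel v
  edgeLabel := fun u => I.edgeLabel s(v, (u : Fin n))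

/-- A deterministic algorithm for the node-capacitated clique on `n` nodes. The identifiers of all
nodes are known to everybody, local memory and local computation are unrestricted, and
the algorithm may even depend on `n` in an arbitrary way (this makes the model only stronger). -/
structure NCCAlgorithm (n ℓ : ℕ) where
  State : Type
  init : Fin n → NodeInput n ℓ → State
  step : Fin n → ℕ → State → List (ℕ × ℕ) → State × List (ℕ × ℕ)
  out : Fin n → State → List (ℕ × ℕ) → List OutItem

/-- `A` solves the problem `P` on all inputs with `n` nodes in `T` rounds of the node-capacitated
clique with capacity `C`: on every input, in every round every node sends at most `C` words and
receives at most `C` words, and after `T` rounds the nodes report a legal output. -/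
def NCCAlgorithm.Solves {κ n : ℕ} (P : GraphProblem κ) (A : NCCAlgorithm n P.labelWords)
    (C T β : ℕ) : Prop :=
  ∀ I ∈ P.inputs n,
    let init := fun v => A.init v (I.atNode v)
    (∀ r < T, ∀ v,
      (sentInRound A.step init r v).length ≤ C ∧
      (∀ msg ∈ sentInRound A.step init r v, msg.1 < n ∧ msg.2 < wordBound κ n) ∧
      (runNetwork A.step init (r + 1) v).2.length ≤ C) ∧
    RepresentsLegal β (P.legal I) fun v =>
      A.out v (runNetwork A.step init T v).1 (runNetwork A.step init T v).2

/-- `P` can be solved in `T` rounds in `NCC(C)`, where `T` and `C` are functions of `n`. -/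
def SolvableInNCC {κ : ℕ} (P : GraphProblem κ) (C T : ℕ → ℕ) : Prop :=
  ∃ (A : (n : ℕ) → NCCAlgorithm n P.labelWords) (β : ℕ), ∀ n, (A n).Solves P (C n) (T n) β

/-! ### Massively parallel computation -/

/-- What a machine sees in a round: the global parameters `n`, `M`, `S` and `a`, its own identifier
and the number of the round, its memory and its inbox. -/
abbrev MachineView := ((ℕ × ℕ × ℕ × ℕ) × (ℕ × ℕ)) × (List ℕ × List (ℕ × ℕ))

/-- A deterministic algorithm for massively parallel computation: one computable program, the same
for all machines and for all sizes. The local state of a machine is its memory, a list of words. -/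
structure MPCAlgorithm where
  step : MachineView → List ℕ × List (ℕ × ℕ)
  out : MachineView → List OutItem
  step_computable : Computable step
  out_computable : Computable out

/-- The step function of machine `i`, with the global parameters filled in. -/
def MPCAlgorithm.localStep (A : MPCAlgorithm) (n M S a : ℕ) (i : Fin M) (r : ℕ)
    (mem : List ℕ) (inbox : List (ℕ × ℕ)) : List ℕ × List (ℕ × ℕ) :=
  A.step (((n, M, S, a), ((i : ℕ), r)), (mem, inbox))

/-- The words that represent the edge `{u, v}`, `u < v`, in the memory of a machine: one word for
the edge, followed by the labels of the edge and of its endpoints. -/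
def edgeRecord {n ℓ : ℕ} (I : GraphInput n ℓ) (e : Fin n × Fin n) : List ℕ :=
  ((e.1 : ℕ) * 2 ^ Nat.size n + (e.2 : ℕ)) ::
    (List.ofFn (I.edgeLabel s(e.1, e.2)) ++
      (List.ofFn (I.nodeLabel e.1) ++ List.ofFn (I.nodeLabel e.2)))

/-- An input representation on `M` machines with memory `S`: the edges of the graph (with their
labels) are distributed over the machines in an arbitrary way and in an arbitrary order, each edge
being stored once, so that no machine holds more than `S` words. -/
def IsInputRep {n ℓ : ℕ} (I : GraphInput n ℓ) (M S : ℕ)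
    (x : Fin M → List (Fin n × Fin n)) : Prop :=
  (List.ofFn x).flatten.Nodup ∧
  (∀ e, e ∈ (List.ofFn x).flatten ↔ e.1 < e.2 ∧ I.graph.Adj e.1 e.2) ∧
  ∀ i, ((x i).flatMap (edgeRecord I)).length ≤ S

/-- `A` solves the problem `P` in `T` rounds in `MPC(M, S)`, where `M`, `S` and `T` are functions
of `n`, and the machines know the value `a n` of the parameter `a`. For every input and every
input representation: at any time the memory of a machine together with the messages that it
has just received are at most `S` words; in every round every machine sends at most `S` words;
and after `T` rounds the machines report a legal output, of at most `S` words per machine. -/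
def MPCAlgorithm.Solves {κ : ℕ} (A : MPCAlgorithm) (P : GraphProblem κ)
    (M S a T : ℕ → ℕ) : Prop :=
  ∃ β : ℕ, ∀ n, ∀ I ∈ P.inputs n, ∀ x : Fin (M n) → List (Fin n × Fin n),
    IsInputRep I (M n) (S n) x →
    let step := A.localStep n (M n) (S n) (a n)
    let init := fun i => (x i).flatMap (edgeRecord I)
    let out := fun i : Fin (M n) =>
      A.out (((n, M n, S n, a n), ((i : ℕ), T n)), runNetwork step init (T n) i)
    (∀ r ≤ T n, ∀ i,
      (runNetwork step init r i).1.length + (runNetwork step init r i).2.length ≤ S n ∧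
      ∀ w ∈ (runNetwork step init r i).1, w < wordBound κ n) ∧
    (∀ r < T n, ∀ i,
      (sentInRound step init r i).length ≤ S n ∧
      ∀ msg ∈ sentInRound step init r i, msg.1 < M n ∧ msg.2 < wordBound κ n) ∧
    (∀ i, ((out i).map List.length).sum ≤ S n) ∧
    RepresentsLegal β (P.legal I) out

/-- `P` can be solved in `T` rounds in `MPC(M, S)`. -/
def SolvableInMPC {κ : ℕ} (P : GraphProblem κ) (M S a T : ℕ → ℕ) : Prop :=
  ∃ A : MPCAlgorithm, A.Solves P M S a T

/-! ### Simulation -/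

/-- `MPC(M, S) ≤_𝒬 NCC(C)`: every algorithm that solves some problem `P ∈ 𝒬` in `MPC(M, S)` in `T`
rounds can be simulated in `NCC(C)` with constant slowdown, i.e. `P` can be solved in `NCC(C)` in
`O(T)` rounds. -/
def MPCDominatedByNCC {κ : ℕ} (𝒬 : Set (GraphProblem κ)) (M S a C : ℕ → ℕ) : Prop :=
  ∀ P ∈ 𝒬, ∀ T : ℕ → ℕ, (∀ n, 1 ≤ T n) → SolvableInMPC P M S a T →
    ∃ (K : ℕ) (T' : ℕ → ℕ), (∀ n, T' n ≤ K * T n) ∧ SolvableInNCC P C T'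

/-! ### Triangle listing -/

open Classical in
/-- The set of all triangles of `G`, each as the list of its corners in increasing order. -/
noncomputable def triangleItems {n : ℕ} (G : SimpleGraph (Fin n)) : Finset OutItem :=
  ((Finset.univ : Finset (Fin n × Fin n × Fin n)).filter fun t =>
      t.1 < t.2.1 ∧ t.2.1 < t.2.2 ∧ G.Adj t.1 t.2.1 ∧ G.Adj t.2.1 t.2.2 ∧ G.Adj t.1 t.2.2).image
    fun t => [(t.1 : ℕ), (t.2.1 : ℕ), (t.2.2 : ℕ)]

theorem triangleItems_size {n : ℕ} (G : SimpleGraph (Fin n)) :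
    ∑ x ∈ triangleItems G, x.length ≤ n ^ 4 := by
  classical
  rcases Nat.lt_or_ge n 3 with hn | hn
  · have h : triangleItems G = ∅ := by
      rw [triangleItems, Finset.image_eq_empty, Finset.filter_eq_empty_iff]
      rintro ⟨u, v, w⟩ - ⟨h1, h2, -⟩
      simp only [Fin.lt_def] at h1 h2
      have := w.isLt
      omega
    rw [h]
    simp
  · have h3 : ∑ x ∈ triangleItems G, x.length = (triangleItems G).card * 3 := by
      rw [Finset.sum_const_nat]
      intro x hx
      obtain ⟨t, -, rfl⟩ := Finset.mem_image.mp hx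
      rfl
    have hc : (triangleItems G).card ≤ n ^ 3 := by
      refine (Finset.card_image_le.trans (Finset.card_filter_le _ _)).trans ?_
      simp only [Finset.card_univ, Fintype.card_prod, Fintype.card_fin]
      exact le_of_eq (by ring)
    rw [h3, pow_succ]
    exact Nat.mul_le_mul hc hn

theorem triangleItems_lt {κ n : ℕ} (hκ : 2 ≤ κ) (G : SimpleGraph (Fin n)) :
    ∀ x ∈ triangleItems G, ∀ w ∈ x, w < wordBound κ n := by
  have key : ∀ u : Fin n, (u : ℕ) < wordBound κ n := fun u =>
    (u.isLt.trans (Nat.lt_size_self n)).trans_le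
      (Nat.pow_le_pow_right (by norm_num) (Nat.le_mul_of_pos_left _ (by omega)))
  intro x hx w hw
  obtain ⟨t, -, rfl⟩ := Finset.mem_image.mp hx
  simp only [List.mem_cons, List.not_mem_nil, or_false] at hw
  rcases hw with rfl | rfl | rfl <;> exact key _

/-- The problem of listing all triangles, for unlabeled input graphs from the class `𝒢`: the only
legal output is the set of all triangles of the graph, so each triangle has to be reported
by at least one machine. -/
noncomputable def triangleListing (κ : ℕ) (hκ : 2 ≤ κ)
    (𝒢 : (n : ℕ) → Set (SimpleGraph (Fin n))) : GraphProblem κ where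
  labelWords := 0
  inputs := fun n => {I | I.graph ∈ 𝒢 n}
  legal := fun I => {triangleItems I.graph}
  outExp := 4
  nodeLabel_lt := fun _ _ _ _ i => i.elim0
  edgeLabel_lt := fun _ _ _ _ i => i.elim0
  out_lt := by
    intro n I _ s hs
    rw [Set.mem_singleton_iff.mp hs]
    exact triangleItems_lt hκ I.graph
  out_size := by
    intro n I _ s hs
    rw [Set.mem_singleton_iff.mp hs]
    exact triangleItems_size I.graph

/-! Put `t = a n - 1`. The hard graphs have `t ^ 2` potential triangles `(x_i, y_j, z_ij)`, whose
three edges are switched on independently by bit vectors `p` (for `xy`), `q` (for `xz`) and `r` (for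
`yz`). Every node is blind to one vector: `Y` does not see `q`, `X` does not see `r`, and all other
nodes do not see `p`. Yet a triangle may be reported only if all three of its bits are true.

Lower bound: record everything that the `2 * t` nodes of `X ∪ Y` send and receive, `L = O(t * C * T
* log n)` bits in all. Given this transcript, `X`, `Y` and the outside act as three players, each
missing one vector. If a player certifies a set of positions, then every value of the hidden vector
in the same transcript class is true on that set, so the class is small; on average a player
certifies at most `L` positions (`sum_card_certified_le`). Since `t ^ 2 / 8` triangles are present
on average, `t ^ 2 ≤ 24 * L` (`card_le_of_three_players`), and a factor `t` cancels.
`NCCAlgorithm.Solves.card_le` links networks to players, and `NCCAlgorithm.Solves.gadget_le` inserts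
the hard graphs.

Upper bound: each potential edge lies in exactly one potential triangle and reveals its number.
Hence one round suffices to send it to the machine in charge, which handles `S / 3` triangles and
receives at most three words for each (`triangleProgram_solves`). Bandwidth in the clique is tied to
the few busy nodes, whereas the machines spread the edges evenly.

Hubs joined to a large block make the graphs connected and fix the arboricity at `t + 1`
(`gadgetGraph_arboricity`) without creating triangles (`gadgetRel_triangle`). -/

/-! ### Bounds on the arboricity -/

/-- A forest on a nonempty finite type has fewer edges than vertices. -/
theorem ncard_edgeSet_lt_of_isAcyclic {V : Type*} [Fintype V] [Nonempty V] {G : SimpleGraph V}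
    (h : G.IsAcyclic) : G.edgeSet.ncard + 1 ≤ Fintype.card V := by
  classical
  obtain ⟨T, hGT, -, hT⟩ :=
    SimpleGraph.connected_top.exists_isTree_le_of_le_of_isAcyclic (le_top : G ≤ ⊤) h
  have h1 := hT.card_edgeFinset
  have h2 : G.edgeSet.ncard ≤ T.edgeSet.ncard :=
    Set.ncard_le_ncard (SimpleGraph.edgeSet_mono hGT) (Set.toFinite _)
  rw [Set.ncard_eq_toFinset_card' T.edgeSet] at h2
  have h3 : T.edgeSet.toFinset = T.edgeFinset := by ext; simp
  rw [h3] at h2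
  omega

/-- Nash-Williams bound: a subgraph with many edges forces a large arboricity. -/
theorem le_of_union_of_forests {V W : Type} [Fintype W] [Nonempty W] (G : SimpleGraph V)
    (f : W ↪ V) {k : ℕ} (F : Fin k → SimpleGraph V) (hF : ∀ i, (F i).IsAcyclic)
    (hG : G = ⨆ i, F i) :
    (G.comap f).edgeSet.ncard ≤ k * (Fintype.card W - 1) := by
  classical
  have h1 : (G.comap f).edgeSet ⊆ ⋃ i, ((F i).comap f).edgeSet := by
    intro e he
    induction e with
    | _ x y =>
      simp only [hG, SimpleGraph.mem_edgeSet, SimpleGraph.comap_adj, SimpleGraph.iSup_adj] at he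
      simpa using he
  calc (G.comap f).edgeSet.ncard ≤ (⋃ i, ((F i).comap f).edgeSet).ncard :=
        Set.ncard_le_ncard h1 (Set.toFinite _)
    _ ≤ ∑ i, ((F i).comap f).edgeSet.ncard := by
        simpa using Finset.set_ncard_biUnion_le Finset.univ fun i => ((F i).comap f).edgeSet
    _ ≤ ∑ _i : Fin k, (Fintype.card W - 1) := by
        refine Finset.sum_le_sum fun i _ => ?_
        have := ncard_edgeSet_lt_of_isAcyclic ((hF i).of_comap f)
        omega
    _ = k * (Fintype.card W - 1) := by simp

/-- A graph in which every vertex has at most one smaller neighbour is a forest. -/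
theorem isAcyclic_of_smaller_unique {V : Type*} [LinearOrder V] (G : SimpleGraph V)
    (h : ∀ v u w, u < v → w < v → G.Adj v u → G.Adj v w → u = w) : G.IsAcyclic := by
  intro v c hc
  -- At the largest vertex of a cycle both cycle neighbours are smaller, hence equal, which no cycle
  -- allows.
  obtain ⟨m, hm, hmax⟩ := c.support.toFinset.exists_max_image id ⟨v, by simp⟩
  simp only [List.mem_toFinset, id] at hm hmax
  have hc' : (c.rotate m hm).IsCycle := hc.rotate hm
  have hmax' : ∀ u ∈ (c.rotate m hm).support, u ≤ m := by
    intro u hu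
    apply hmax
    rwa [SimpleGraph.Walk.mem_support_rotate_iff] at hu
  generalize c.rotate m hm = d at hc' hmax'
  have hn : ¬ d.Nil := hc'.not_nil
  have h1 := d.adj_snd hn
  have h2 := (d.adj_penultimate hn).symm
  have l1 : d.snd < m := lt_of_le_of_ne (hmax' _ (d.getVert_mem_support _)) h1.ne'
  have l2 : d.penultimate < m := lt_of_le_of_ne (hmax' _ (d.getVert_mem_support _)) h2.ne'
  exact hc'.snd_ne_penultimate (h m _ _ l1 l2 h1 h2)

/-- If every vertex has at most `k` smaller neighbours, then the edge set is the union of `k`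
edge-disjoint forests. -/
theorem exists_forests_of_smaller_card {V : Type} [LinearOrder V] [Finite V]
    (G : SimpleGraph V) (k : ℕ) (h : ∀ v, {u | u < v ∧ G.Adj v u}.ncard ≤ k) :
    ∃ F : Fin k → SimpleGraph V,
      (∀ i, (F i).IsAcyclic) ∧ Pairwise (fun i j => Disjoint (F i) (F j)) ∧ G = ⨆ i, F i := by
  classical
  -- Number the smaller neighbours of each `v` injectively by `Fin k`; forest `i` consists of the
  -- edges from each `v` down to its neighbour number `i`. The `Unit` value is padding for all other
  -- vertices.
  have hc : ∀ v, ∃ g : V → Fin k ⊕ Unit,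
      (∀ u, u < v ∧ G.Adj v u → ∃ i, g u = Sum.inl i) ∧
      ∀ u w, (u < v ∧ G.Adj v u) → (w < v ∧ G.Adj v w) → g u = g w → u = w := by
    intro v
    have : Fintype {u | u < v ∧ G.Adj v u} := Fintype.ofFinite _
    have hcard : Fintype.card {u | u < v ∧ G.Adj v u} ≤ Fintype.card (Fin k) := by
      rw [Fintype.card_fin, ← Nat.card_eq_fintype_card]
      exact h v
    obtain ⟨g⟩ := Function.Embedding.nonempty_of_card_le hcard
    refine ⟨fun u => if hu : u < v ∧ G.Adj v u then Sum.inl (g ⟨u, hu⟩) else Sum.inr (), ?_, ?_⟩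
    · intro u hu
      exact ⟨_, dif_pos hu⟩
    · intro u w hu hw huw
      simp only [dif_pos hu, dif_pos hw] at huw
      simpa using g.injective (Sum.inl_injective huw)
  choose g hg1 hg2 using hc
  let F : Fin k → SimpleGraph V := fun i =>
    { Adj := fun u v => G.Adj u v ∧ g (max u v) (min u v) = Sum.inl i
      symm := ⟨fun u v huv => ⟨huv.1.symm, by rw [max_comm, min_comm]; exact huv.2⟩⟩
      loopless := ⟨fun u hu => hu.1.ne rfl⟩ }
  refine ⟨F, fun i => ?_, fun i j hij => ?_, ?_⟩
  · apply isAcyclic_of_smaller_unique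
    rintro v u w hu hw ⟨h1, h2⟩ ⟨h3, h4⟩
    rw [max_eq_left hu.le, min_eq_right hu.le] at h2
    rw [max_eq_left hw.le, min_eq_right hw.le] at h4
    exact hg2 v u w ⟨hu, h1⟩ ⟨hw, h3⟩ (h2.trans h4.symm)
  · show Disjoint (F i) (F j)
    rw [SimpleGraph.disjoint_left]
    rintro x y ⟨-, h1⟩ ⟨-, h2⟩
    exact hij (Sum.inl_injective (h1.symm.trans h2))
  · ext u v
    rw [SimpleGraph.iSup_adj]
    constructor
    · intro huv
      rcases lt_or_gt_of_ne huv.ne with hlt | hlt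
      · obtain ⟨i, hi⟩ := hg1 v u ⟨hlt, huv.symm⟩
        exact ⟨i, huv, by rwa [max_eq_right hlt.le, min_eq_left hlt.le]⟩
      · obtain ⟨i, hi⟩ := hg1 u v ⟨hlt, huv⟩
        exact ⟨i, huv, by rwa [max_eq_left hlt.le, min_eq_right hlt.le]⟩
    · rintro ⟨i, hi⟩
      exact hi.1

/-- The arboricity is `k` if every vertex has at most `k` smaller neighbours and there is a
subgraph with too many edges for `k - 1` forests. -/
theorem arboricity_eq {V W : Type} [LinearOrder V] [Finite V] [Fintype W] [Nonempty W]
    (G : SimpleGraph V) (k : ℕ) (h : ∀ v, {u | u < v ∧ G.Adj v u}.ncard ≤ k) (f : W ↪ V)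
    (hf : (k - 1) * (Fintype.card W - 1) < (G.comap f).edgeSet.ncard) : arboricity G = k := by
  apply le_antisymm
  · exact Nat.sInf_le (exists_forests_of_smaller_card G k h)
  · refine le_csInf ⟨k, exists_forests_of_smaller_card G k h⟩ ?_
    rintro j ⟨F, hF, -, hG⟩
    by_contra! hj
    have h1 := le_of_union_of_forests G f F hF hG
    have h2 : j * (Fintype.card W - 1) ≤ (k - 1) * (Fintype.card W - 1) :=
      Nat.mul_le_mul_right _ (by omega)
    omega

/-! ### Counting -/

/-- Linear lower bound for powers of two around `2 ^ L`. -/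
theorem two_pow_mul_succ_le (k L : ℕ) : 2 ^ L * (k + 1) ≤ 2 ^ k + 2 ^ L * L := by
  -- This is `2 ^ k ≥ 2 ^ L * (1 + k - L)` free of subtraction. For `k < L` the right side is not
  -- positive; otherwise divide by `2 ^ L`.
  rcases Nat.lt_or_ge k L with h | h
  · have : 2 ^ L * (k + 1) ≤ 2 ^ L * L := Nat.mul_le_mul_left _ h
    exact this.trans (Nat.le_add_left _ _)
  · obtain ⟨d, rfl⟩ := Nat.exists_eq_add_of_le h
    have : d + 1 ≤ 2 ^ d := Nat.lt_two_pow_self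
    rw [pow_add]
    nlinarith [Nat.pos_of_ne_zero (pow_ne_zero L two_ne_zero)]

/-- The number of Boolean functions that are true on a given set. -/
theorem card_bool_true_on {E : Type*} [Fintype E] [DecidableEq E] (s : Finset E) :
    (Finset.univ.filter fun f : E → Bool => ∀ e ∈ s, f e = true).card * 2 ^ s.card
      = 2 ^ Fintype.card E := by
  have h : (Finset.univ.filter fun f : E → Bool => ∀ e ∈ s, f e = true)
      = Fintype.piFinset fun e => if e ∈ s then {true} else Finset.univ := by
    ext f
    simp only [Finset.mem_filter, Finset.mem_univ, true_and, Fintype.mem_piFinset]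
    refine forall_congr' fun e => ?_
    by_cases he : e ∈ s <;> simp [he]
  have h2 : ∀ e : E, (if e ∈ s then {true} else Finset.univ : Finset Bool).card
      = if e ∈ s then 1 else 2 := by
    intro e; split_ifs <;> simp
  rw [h, Fintype.card_piFinset, Finset.prod_congr rfl fun e _ => h2 e,
    Finset.prod_ite, Finset.prod_const_one, one_mul, Finset.prod_const, ← pow_add]
  congr 1
  have h3 : Finset.univ.filter (fun e => e ∉ s) = sᶜ := by ext; simp
  rw [h3, Finset.card_compl]
  have := Finset.card_le_univ s
  omega

/-- A player sees a transcript `τ` that takes at most `2 ^ L` values and some data `y ∈ B`, but not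
the bit vector `x`. On average it can certify at most `L` positions where `x` is true. -/
theorem sum_card_certified_le {E B Q : Type*} [Fintype E] [DecidableEq E] [Fintype B] [Fintype Q]
    (L : ℕ) (hQ : Fintype.card Q ≤ 2 ^ L) (τ : (E → Bool) → B → Q)
    (R : (E → Bool) → B → Finset E)
    (hR : ∀ x x' y, τ x y = τ x' y → R x y = R x' y)
    (htrue : ∀ x y, ∀ e ∈ R x y, x e = true) :
    ∑ y : B, ∑ x : E → Bool, (R x y).card ≤ L * (Fintype.card B * 2 ^ Fintype.card E) := by
  classical
  have key : ∀ y : B, ∑ x : E → Bool, (R x y).card ≤ L * 2 ^ Fintype.card E := by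
    intro y
    -- For fixed `y`, the set `R` is constant on each fibre of `τ`, and all vectors in the fibre are
    -- true on it. So the fibre has at most `2 ^ (|E| - |R|)` elements and contributes at most `2 ^
    -- |E|`; there are at most `2 ^ L` fibres.
    have h1 : ∑ x : E → Bool, 2 ^ (R x y).card ≤ 2 ^ L * 2 ^ Fintype.card E := by
      calc ∑ x : E → Bool, 2 ^ (R x y).card
          = ∑ q : Q, ∑ x : E → Bool with τ x y = q, 2 ^ (R x y).card :=
            (Finset.sum_fiberwise _ _ _).symm
        _ ≤ ∑ _q : Q, 2 ^ Fintype.card E := by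
            refine Finset.sum_le_sum fun q _ => ?_
            rcases (Finset.univ.filter fun x : E → Bool => τ x y = q).eq_empty_or_nonempty
              with h0 | ⟨x₀, hx₀⟩
            · rw [h0]; simp
            · have hx₀' := (Finset.mem_filter.mp hx₀).2
              rw [← card_bool_true_on (R x₀ y), ← smul_eq_mul]
              calc ∑ x : E → Bool with τ x y = q, 2 ^ (R x y).card
                  = ∑ x : E → Bool with τ x y = q, 2 ^ (R x₀ y).card := by
                    refine Finset.sum_congr rfl fun x hx => ?_
                    rw [hR x x₀ y ((Finset.mem_filter.mp hx).2.trans hx₀'.symm)]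
                _ = (Finset.univ.filter fun x : E → Bool => τ x y = q).card
                      • 2 ^ (R x₀ y).card := Finset.sum_const _
                _ ≤ _ := by
                    refine Nat.mul_le_mul_right _ (Finset.card_le_card fun x hx => ?_)
                    have hx' := (Finset.mem_filter.mp hx).2
                    refine Finset.mem_filter.mpr ⟨Finset.mem_univ _, fun e he => ?_⟩
                    exact htrue x y e (by rwa [hR x x₀ y (hx'.trans hx₀'.symm)])
        _ = Fintype.card Q * 2 ^ Fintype.card E := by simp
        _ ≤ 2 ^ L * 2 ^ Fintype.card E := Nat.mul_le_mul_right _ hQ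
    -- The linear bound at `L` plays the part of Jensen's inequality, passing from the mean of `2 ^
    -- |R|` to the mean of `|R|`.
    have h2 : 2 ^ L * (∑ x : E → Bool, (R x y).card + 2 ^ Fintype.card E)
        ≤ ∑ x : E → Bool, 2 ^ (R x y).card + 2 ^ L * (L * 2 ^ Fintype.card E) := by
      have h3 := Finset.sum_le_sum fun (x : E → Bool) (_ : x ∈ Finset.univ) =>
        two_pow_mul_succ_le (R x y).card L
      simp only [Finset.sum_add_distrib, ← Finset.mul_sum, Finset.sum_const, Finset.card_univ,
        Fintype.card_fun, Fintype.card_bool, smul_eq_mul, mul_one] at h3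
      calc _ ≤ _ := h3
        _ = _ := by ring
    have h4 : 2 ^ L * ∑ x : E → Bool, (R x y).card ≤ 2 ^ L * (L * 2 ^ Fintype.card E) := by
      rw [mul_add] at h2; omega
    exact Nat.le_of_mul_le_mul_left h4 (by positivity)
  calc ∑ y : B, ∑ x : E → Bool, (R x y).card ≤ ∑ _y : B, L * 2 ^ Fintype.card E :=
        Finset.sum_le_sum fun y _ => key y
    _ = _ := by simp; ring

/-- The average number of positions where three bit vectors are simultaneously true. -/
theorem sum_card_all_true {E : Type*} [Fintype E] [DecidableEq E] :
    8 * ∑ x : E → Bool, ∑ y : E → Bool, ∑ z : E → Bool,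
      (Finset.univ.filter fun e => x e = true ∧ y e = true ∧ z e = true).card
      = Fintype.card E * (2 ^ Fintype.card E * 2 ^ Fintype.card E * 2 ^ Fintype.card E) := by
  classical
  have hone : ∀ e : E, 2 * ∑ x : E → Bool, (if x e = true then 1 else 0) = 2 ^ Fintype.card E := by
    intro e
    have := card_bool_true_on ({e} : Finset E)
    simp only [Finset.mem_singleton, forall_eq, Finset.card_singleton, pow_one] at this
    rw [← Finset.card_filter]
    omega
  have h1 : ∀ x y z : E → Bool,
      (Finset.univ.filter fun e => x e = true ∧ y e = true ∧ z e = true).card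
      = ∑ e : E, (if x e = true then 1 else 0) * ((if y e = true then 1 else 0)
          * (if z e = true then 1 else 0)) := by
    intro x y z
    rw [Finset.card_filter]
    refine Finset.sum_congr rfl fun e _ => ?_
    by_cases hx : x e = true <;> by_cases hy : y e = true <;> by_cases hz : z e = true <;>
      simp [hx, hy, hz]
  simp only [h1]
  -- Linearity and independence: with the sum over `e` outermost, the summand factors, and each
  -- factor counts half of all vectors.
  have h2 : ∑ x : E → Bool, ∑ y : E → Bool, ∑ z : E → Bool,
      ∑ e : E, (if x e = true then 1 else 0) * ((if y e = true then 1 else 0)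
          * (if z e = true then 1 else 0))
      = ∑ e : E, (∑ x : E → Bool, (if x e = true then 1 else 0)) *
        ((∑ y : E → Bool, (if y e = true then 1 else 0)) *
          (∑ z : E → Bool, (if z e = true then 1 else 0))) := by
    have e1 : ∀ x y : E → Bool, ∑ z : E → Bool,
      ∑ e : E, (if x e = true then 1 else 0) * ((if y e = true then 1 else 0)
          * (if z e = true then 1 else 0)) = ∑ e : E, ∑ z : E → Bool,
        (if x e = true then 1 else 0) * ((if y e = true then 1 else 0)
          * (if z e = true then 1 else 0)) := fun x y => Finset.sum_comm
    simp only [e1]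
    have e2 : ∀ x : E → Bool, ∑ y : E → Bool, ∑ e : E, ∑ z : E → Bool,
        (if x e = true then 1 else 0) * ((if y e = true then 1 else 0)
          * (if z e = true then 1 else 0)) = ∑ e : E, ∑ y : E → Bool, ∑ z : E → Bool,
        (if x e = true then 1 else 0) * ((if y e = true then 1 else 0)
          * (if z e = true then 1 else 0)) := fun x => Finset.sum_comm
    simp only [e2]
    rw [Finset.sum_comm]
    refine Finset.sum_congr rfl fun e _ => ?_
    rw [Finset.sum_mul_sum, Finset.sum_mul]
    refine Finset.sum_congr rfl fun x _ => ?_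
    rw [Finset.mul_sum]
    refine Finset.sum_congr rfl fun y _ => ?_
    rw [Finset.mul_sum]
  rw [h2, Finset.mul_sum]
  have h3 : ∀ e : E, 8 * ((∑ x : E → Bool, (if x e = true then 1 else 0)) *
        ((∑ y : E → Bool, (if y e = true then 1 else 0)) *
          (∑ z : E → Bool, (if z e = true then 1 else 0))))
      = 2 ^ Fintype.card E * 2 ^ Fintype.card E * 2 ^ Fintype.card E := by
    intro e
    rw [← hone e]; ring
  rw [Finset.sum_congr rfl fun e _ => h3 e]
  simp

/-- Three players share a transcript with at most `2 ^ L` values; each of them sees two of three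
bit vectors of length `N`. If every position where all three vectors are true is certified by some
player, then `N ≤ 24 * L`. -/
theorem card_le_of_three_players {E Q : Type*} [Fintype E] [DecidableEq E] [Fintype Q]
    (L : ℕ) (hQ : Fintype.card Q ≤ 2 ^ L)
    (τ : (E → Bool) → (E → Bool) → (E → Bool) → Q)
    (R₁ R₂ R₃ : (E → Bool) → (E → Bool) → (E → Bool) → Finset E)
    (h₁ : ∀ x x' y z, τ x y z = τ x' y z → R₁ x y z = R₁ x' y z)
    (h₂ : ∀ x y y' z, τ x y z = τ x y' z → R₂ x y z = R₂ x y' z)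
    (h₃ : ∀ x y z z', τ x y z = τ x y z' → R₃ x y z = R₃ x y z')
    (t₁ : ∀ x y z, ∀ e ∈ R₁ x y z, x e = true)
    (t₂ : ∀ x y z, ∀ e ∈ R₂ x y z, y e = true)
    (t₃ : ∀ x y z, ∀ e ∈ R₃ x y z, z e = true)
    (hcover : ∀ x y z e, x e = true → y e = true → z e = true →
      e ∈ R₁ x y z ∨ e ∈ R₂ x y z ∨ e ∈ R₃ x y z) :
    Fintype.card E ≤ 24 * L := by
  classical
  have b₁ := sum_card_certified_le (B := (E → Bool) × (E → Bool)) L hQ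
    (fun x w => τ x w.1 w.2) (fun x w => R₁ x w.1 w.2)
    (fun x x' w h => h₁ x x' w.1 w.2 h) (fun x w e he => t₁ x w.1 w.2 e he)
  have b₂ := sum_card_certified_le (B := (E → Bool) × (E → Bool)) L hQ
    (fun y w => τ w.1 y w.2) (fun y w => R₂ w.1 y w.2)
    (fun y y' w h => h₂ w.1 y y' w.2 h) (fun y w e he => t₂ w.1 y w.2 e he)
  have b₃ := sum_card_certified_le (B := (E → Bool) × (E → Bool)) L hQ
    (fun z w => τ w.1 w.2 z) (fun z w => R₃ w.1 w.2 z)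
    (fun z z' w h => h₃ w.1 w.2 z z' h) (fun z w e he => t₃ w.1 w.2 z e he)
  simp only [Fintype.sum_prod_type, Fintype.card_prod, Fintype.card_fun, Fintype.card_bool]
    at b₁ b₂ b₃
  have c₁ : ∑ y : E → Bool, ∑ z : E → Bool, ∑ x : E → Bool, (R₁ x y z).card
      = ∑ x : E → Bool, ∑ y : E → Bool, ∑ z : E → Bool, (R₁ x y z).card := by
    rw [Finset.sum_congr rfl fun y _ => Finset.sum_comm, Finset.sum_comm]
  have c₂ : ∑ x : E → Bool, ∑ z : E → Bool, ∑ y : E → Bool, (R₂ x y z).card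
      = ∑ x : E → Bool, ∑ y : E → Bool, ∑ z : E → Bool, (R₂ x y z).card :=
    Finset.sum_congr rfl fun x _ => Finset.sum_comm
  rw [c₁] at b₁
  rw [c₂] at b₂
  have hsum : ∑ x : E → Bool, ∑ y : E → Bool, ∑ z : E → Bool,
      (Finset.univ.filter fun e => x e = true ∧ y e = true ∧ z e = true).card
      ≤ ∑ x : E → Bool, ∑ y : E → Bool, ∑ z : E → Bool, (R₁ x y z).card
        + ∑ x : E → Bool, ∑ y : E → Bool, ∑ z : E → Bool, (R₂ x y z).card
        + ∑ x : E → Bool, ∑ y : E → Bool, ∑ z : E → Bool, (R₃ x y z).card := by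
    simp only [← Finset.sum_add_distrib]
    refine Finset.sum_le_sum fun x _ => Finset.sum_le_sum fun y _ => Finset.sum_le_sum fun z _ => ?_
    refine (Finset.card_le_card (t := R₁ x y z ∪ R₂ x y z ∪ R₃ x y z) fun e he => ?_).trans
      ((Finset.card_union_le _ _).trans (Nat.add_le_add_right (Finset.card_union_le _ _) _))
    obtain ⟨hx, hy, hz⟩ := (Finset.mem_filter.mp he).2
    have := hcover x y z e hx hy hz
    simp only [Finset.mem_union]
    tauto
  have htot := sum_card_all_true (E := E)
  set D := 2 ^ Fintype.card E * 2 ^ Fintype.card E * 2 ^ Fintype.card E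
  have hD : 0 < D := by positivity
  -- The mean number of all-true positions is `|E| / 8`, and the three players together certify at
  -- most `3 * L` on average; hence `24 = 8 * 3`.
  have : Fintype.card E * D ≤ (24 * L) * D := by
    rw [← htot]
    have : (24 * L) * D = 8 * (L * D + L * D + L * D) := by ring
    rw [this]
    refine Nat.mul_le_mul_left _ (hsum.trans ?_)
    exact Nat.add_le_add (Nat.add_le_add b₁ b₂) b₃
  exact Nat.le_of_mul_le_mul_right this hD

/-! ### Transcripts of the node-capacitated clique -/

section Network

variable {m : ℕ} {σ : Type} {step : Fin m → ℕ → σ → List (ℕ × ℕ) → σ × List (ℕ × ℕ)}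
  {init init' : Fin m → σ} {T : ℕ}

theorem runNetwork_succ_fst (r : ℕ) (v : Fin m) :
    (runNetwork step init (r + 1) v).1
      = (step v r (runNetwork step init r v).1 (runNetwork step init r v).2).1 := rfl

theorem runNetwork_succ_snd (r : ℕ) (v : Fin m) :
    (runNetwork step init (r + 1) v).2 = deliver (sentInRound step init r) v := rfl

/-- The run of a single machine is determined by its initial state and its inboxes. -/
theorem runNetwork_eq_of_inbox_eq {v : Fin m} (h0 : init v = init' v)
    (hin : ∀ r < T, (runNetwork step init (r + 1) v).2 = (runNetwork step init' (r + 1) v).2) :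
    ∀ r ≤ T, runNetwork step init r v = runNetwork step init' r v := by
  intro r
  induction r with
  | zero => intro _; simp [runNetwork, h0]
  | succ r ih =>
    intro hr
    refine Prod.ext ?_ (hin r hr)
    rw [runNetwork_succ_fst, runNetwork_succ_fst, ih (by omega)]

/-- The run of the machines outside `K` is determined by their initial states and by what the
machines in `K` send. -/
theorem runNetwork_eq_of_sent_eq {K : Finset (Fin m)} (h0 : ∀ v ∉ K, init v = init' v)
    (hout : ∀ r < T, ∀ v ∈ K, sentInRound step init r v = sentInRound step init' r v) :
    ∀ r ≤ T, ∀ v ∉ K, runNetwork step init r v = runNetwork step init' r v := by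
  intro r
  induction r with
  | zero => intro _ v hv; simp [runNetwork, h0 v hv]
  | succ r ih =>
    intro hr v hv
    have hs : sentInRound step init r = sentInRound step init' r := by
      funext w
      by_cases hw : w ∈ K
      · exact hout r hr w hw
      · rw [sentInRound, sentInRound, ih (by omega) w hw]
    refine Prod.ext ?_ ?_
    · rw [runNetwork_succ_fst, runNetwork_succ_fst, ih (by omega) v hv]
    · rw [runNetwork_succ_snd, runNetwork_succ_snd, hs]

end Network

/-! ### Counting transcripts, and the reduction to three players -/

/-- The sender of a delivered message is a machine, and its word was sent by that machine. -/
theorem mem_deliver {m : ℕ} {outbox : Fin m → List (ℕ × ℕ)} {i : Fin m} {msg : ℕ × ℕ} :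
    msg ∈ deliver outbox i ↔ ∃ j : Fin m, msg.1 = j ∧ ((i : ℕ), msg.2) ∈ outbox j := by
  simp only [deliver, List.mem_flatMap, List.mem_finRange, true_and, List.mem_map,
    List.mem_filter, decide_eq_true_eq]
  constructor
  · rintro ⟨j, a, ⟨h1, h2⟩, rfl⟩
    exact ⟨j, rfl, by rw [← h2]; exact h1⟩
  · rintro ⟨j, h1, h2⟩
    exact ⟨j, _, ⟨h2, rfl⟩, by rw [← h1]⟩

/-- A list of at most `C` messages, as an element of a finite type. -/
def encodeMessages (n W C : ℕ) (l : List (ℕ × ℕ)) (i : Fin C) : Option (Fin n × Fin W) :=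
  l[(i : ℕ)]?.bind fun p =>
    if h : p.1 < n ∧ p.2 < W then some (⟨p.1, h.1⟩, ⟨p.2, h.2⟩) else none

/-- The encoding cuts a list off after `C` entries and turns out-of-range entries into `none`; the
bounds exclude both losses, so every entry can be read back. -/
theorem encodeMessages_inj {n W C : ℕ} {l l' : List (ℕ × ℕ)} (hl : l.length ≤ C)
    (hl' : l'.length ≤ C) (hb : ∀ p ∈ l, p.1 < n ∧ p.2 < W) (hb' : ∀ p ∈ l', p.1 < n ∧ p.2 < W)
    (h : encodeMessages n W C l = encodeMessages n W C l') : l = l' := by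
  have dec : ∀ l : List (ℕ × ℕ), (∀ p ∈ l, p.1 < n ∧ p.2 < W) → ∀ i : Fin C,
      l[(i : ℕ)]? = (encodeMessages n W C l i).map fun p => ((p.1 : ℕ), (p.2 : ℕ)) := by
    intro l hb i
    rcases hi : l[(i : ℕ)]? with _ | p
    · simp [encodeMessages, hi]
    · have := hb p (List.mem_of_getElem? hi)
      simp [encodeMessages, hi, this]
  refine List.ext_getElem? fun i => ?_
  rcases Nat.lt_or_ge i C with hi | hi
  · rw [dec l hb ⟨i, hi⟩, dec l' hb' ⟨i, hi⟩, h]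
  · rw [List.getElem?_eq_none (hl.trans hi), List.getElem?_eq_none (hl'.trans hi)]

/-- A slot holds a machine number, of at most `Nat.size n` bits, and a word of `κ * Nat.size n`
bits; one further bit pays for `none`. -/
theorem card_messages_le (κ n C : ℕ) :
    Fintype.card (Fin C → Option (Fin n × Fin (wordBound κ n)))
      ≤ 2 ^ (((κ + 1) * Nat.size n + 1) * C) := by
  simp only [Fintype.card_fun, Fintype.card_option, Fintype.card_prod, Fintype.card_fin]
  rw [pow_mul]
  refine Nat.pow_le_pow_left ?_ C
  have h1 : n * wordBound κ n ≤ 2 ^ ((κ + 1) * Nat.size n) := by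
    rw [add_mul, one_mul, add_comm, pow_add]
    exact Nat.mul_le_mul_right _ (Nat.lt_size_self n).le
  rw [pow_succ]
  have : 1 ≤ 2 ^ ((κ + 1) * Nat.size n) := Nat.one_le_two_pow
  omega

/-- The numbers of the senders and the words in an inbox are in range. -/
theorem NCCAlgorithm.Solves.inbox_bound {κ n : ℕ} {P : GraphProblem κ}
    {A : NCCAlgorithm n P.labelWords} {C T β : ℕ} (hA : A.Solves P C T β)
    {I : GraphInput n P.labelWords} (hI : I ∈ P.inputs n) {r : ℕ} (hr : r < T) (v : Fin n) :
    ∀ p ∈ (runNetwork A.step (fun v => A.init v (I.atNode v)) (r + 1) v).2,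
      p.1 < n ∧ p.2 < wordBound κ n := by
  intro p hp
  rw [runNetwork_succ_snd, mem_deliver] at hp
  obtain ⟨j, hj, hp⟩ := hp
  exact ⟨hj ▸ j.isLt, (((hA I hI).1 r hr j).2.1 _ hp).2⟩

/-- The information-theoretic lower bound. Suppose that the inputs are given by three bit vectors
`p`, `q`, `r`, such that the nodes outside `X ∪ Y` do not see `p`, the nodes in `Y` do not see `q`
and the nodes in `X` do not see `r`, and that the item `item e` has to be reported if and only
if `p e`, `q e` and `r e` are all true. Then the nodes of `X ∪ Y` have to exchange a number of bits
that is linear in the length of the vectors. -/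
theorem NCCAlgorithm.Solves.card_le {κ n : ℕ} {P : GraphProblem κ}
    {A : NCCAlgorithm n P.labelWords} {C T β : ℕ} (hA : A.Solves P C T β)
    {E : Type*} [Fintype E]
    (I : (E → Bool) → (E → Bool) → (E → Bool) → GraphInput n P.labelWords)
    (hI : ∀ p q r, I p q r ∈ P.inputs n) (X Y : Finset (Fin n))
    (hp : ∀ p p' q r, ∀ v ∉ X ∪ Y, (I p q r).atNode v = (I p' q r).atNode v)
    (hq : ∀ p q q' r, ∀ v ∈ Y, (I p q r).atNode v = (I p q' r).atNode v)
    (hr : ∀ p q r r', ∀ v ∈ X, (I p q r).atNode v = (I p q r').atNode v)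
    (item : E → OutItem)
    (hitem : ∀ p q r, ∀ s ∈ P.legal (I p q r), ∀ e,
      item e ∈ s ↔ p e = true ∧ q e = true ∧ r e = true) :
    Fintype.card E ≤
      24 * (((κ + 1) * Nat.size n + 1) * C * (2 * ((X ∪ Y).card * T))) := by
  classical
  let run := fun p q r t v => runNetwork A.step (fun v => A.init v ((I p q r).atNode v)) t v
  let sent := fun p q r t v => sentInRound A.step (fun v => A.init v ((I p q r).atNode v)) t v
  let enc := encodeMessages n (wordBound κ n) C
  -- Both directions are recorded, whence the factor 2 in the bound: inboxes determine the run of a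
  -- node in `X ∪ Y`, while outboxes determine the runs outside.
  let τ : (E → Bool) → (E → Bool) → (E → Bool) → (↥(X ∪ Y) × Fin T) →
      (Fin C → Option (Fin n × Fin (wordBound κ n))) ×
        (Fin C → Option (Fin n × Fin (wordBound κ n))) :=
    fun p q r w => (enc (run p q r (w.2 + 1) w.1).2, enc (sent p q r w.2 w.1))
  have hτ : ∀ {p q r p' q' r'}, τ p q r = τ p' q' r' → ∀ t < T, ∀ v ∈ X ∪ Y,
      (run p q r (t + 1) v).2 = (run p' q' r' (t + 1) v).2 ∧ sent p q r t v = sent p' q' r' t v := by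
    intro p q r p' q' r' h t ht v hv
    have h1 := congrFun h (⟨v, hv⟩, ⟨t, ht⟩)
    have b := ((hA _ (hI p q r)).1 t ht v)
    have b' := ((hA _ (hI p' q' r')).1 t ht v)
    exact ⟨encodeMessages_inj b.2.2 b'.2.2 (hA.inbox_bound (hI p q r) ht v)
        (hA.inbox_bound (hI p' q' r') ht v) (congrArg Prod.fst h1),
      encodeMessages_inj b.1 b'.1 b.2.1 b'.2.1 (congrArg Prod.snd h1)⟩
  have hcore : ∀ {p q r p' q' r'}, τ p q r = τ p' q' r' → ∀ v ∈ X ∪ Y,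
      (I p q r).atNode v = (I p' q' r').atNode v → run p q r T v = run p' q' r' T v := by
    intro p q r p' q' r' h v hv h0
    exact runNetwork_eq_of_inbox_eq (congrArg (A.init v) h0)
      (fun t ht => (hτ h t ht v hv).1) T le_rfl
  let rep : (Fin n → Prop) → (E → Bool) → (E → Bool) → (E → Bool) → Finset E := fun S p q r =>
    Finset.univ.filter fun e => ∃ v, S v ∧ item e ∈ A.out v (run p q r T v).1 (run p q r T v).2
  have hrep : ∀ (S : Fin n → Prop) {p q r p' q' r'},
      (∀ v, S v → run p q r T v = run p' q' r' T v) → rep S p q r = rep S p' q' r' := by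
    intro S p q r p' q' r' h
    refine Finset.filter_congr fun e _ => exists_congr fun v => and_congr_right fun hv => ?_
    rw [h v hv]
  have htrue : ∀ S p q r, ∀ e ∈ rep S p q r, p e = true ∧ q e = true ∧ r e = true := by
    intro S p q r e he
    obtain ⟨v, -, hv⟩ := (Finset.mem_filter.mp he).2
    obtain ⟨s, hs, h1, -⟩ := (hA _ (hI p q r)).2
    exact (hitem p q r s hs e).mp ((h1 _).mpr ⟨v, hv⟩)
  -- The player missing `p` is the outside, the one missing `q` is `Y`, and the one missing `r` is
  -- `X`. What a player reports is certified because a legal output contains no absent item.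
  refine card_le_of_three_players _ ?_ τ (rep fun v => v ∉ X ∪ Y) (rep fun v => v ∈ Y)
    (rep fun v => v ∈ X) ?_ ?_ ?_ (fun p q r e he => (htrue _ p q r e he).1)
    (fun p q r e he => (htrue _ p q r e he).2.1) (fun p q r e he => (htrue _ p q r e he).2.2) ?_
  · rw [Fintype.card_fun, Fintype.card_prod, Fintype.card_prod, Fintype.card_coe, Fintype.card_fin,
      ← pow_two, ← pow_mul, pow_mul 2]
    exact Nat.pow_le_pow_left (card_messages_le κ n C) _
  · intro p p' q r h
    refine hrep _ fun v hv => ?_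
    -- Messages among outside nodes are not in the transcript, so the outside has to be simulated as
    -- a whole.
    exact runNetwork_eq_of_sent_eq (K := X ∪ Y)
      (fun w hw => congrArg (A.init w) (hp p p' q r w hw))
      (fun t ht w hw => (hτ h t ht w hw).2) T le_rfl v hv
  · intro p q q' r h
    exact hrep _ fun v hv => hcore h v (Finset.mem_union_right _ hv) (hq p q q' r v hv)
  · intro p q r r' h
    exact hrep _ fun v hv => hcore h v (Finset.mem_union_left _ hv) (hr p q r r' v hv)
  · intro p q r e hpe hqe hre
    obtain ⟨s, hs, h1, -⟩ := (hA _ (hI p q r)).2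
    obtain ⟨v, hv⟩ := (h1 _).mp ((hitem p q r s hs e).mpr ⟨hpe, hqe, hre⟩)
    simp only [rep, Finset.mem_filter, Finset.mem_univ, true_and]
    by_cases hX : v ∈ X
    · exact Or.inr (Or.inr ⟨v, hX, hv⟩)
    by_cases hY : v ∈ Y
    · exact Or.inr (Or.inl ⟨v, hY, hv⟩)
    · exact Or.inl ⟨v, by simp [hX, hY], hv⟩

/-! ### The hard graphs

The identifiers are split into consecutive blocks: `t + 1` hubs, two blocks `X` and `Y` of
`t` nodes, a block `Z` of `t * t` nodes, a block `W` of `(t + 1) * (t + 1)` nodes, and the rest.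
The hubs and `W` form a complete bipartite graph, which makes the arboricity `t + 1`. The hub `0`
is joined to `X` and to the rest, the hub `1` to `Y`, the hub `2` to `Z`. For `e = i * t + j`, the
node `e` of `Z` together with node `i` of `X` and node `j` of `Y` may form a triangle; the three
edges are present if and only if `p e`, `q e`, `r e` respectively hold. There are no other
triangles, and there are at most `n + (t + 1) ^ 3 + 3 * t ^ 2` edges. -/

/-- The smaller node `u` is adjacent to the larger node `v`. -/
def gadgetRel (t : ℕ) (p q r : ℕ → Prop) (u v : ℕ) : Prop :=
  (u ≤ t ∧ 3 * t + 1 + t * t ≤ v ∧ v < 3 * t + 1 + t * t + (t + 1) * (t + 1)) ∨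
  (u = 0 ∧ 3 * t + 1 + t * t + (t + 1) * (t + 1) ≤ v) ∨
  (u = 0 ∧ t + 1 ≤ v ∧ v < 2 * t + 1) ∨
  (u = 1 ∧ 2 * t + 1 ≤ v ∧ v < 3 * t + 1) ∨
  (u = 2 ∧ 3 * t + 1 ≤ v ∧ v < 3 * t + 1 + t * t) ∨
  ∃ i < t, ∃ j < t,
    (u = t + 1 + i ∧ v = 2 * t + 1 + j ∧ p (i * t + j)) ∨
    (u = t + 1 + i ∧ v = 3 * t + 1 + (i * t + j) ∧ q (i * t + j)) ∨
    (u = 2 * t + 1 + j ∧ v = 3 * t + 1 + (i * t + j) ∧ r (i * t + j))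

theorem pair_lt {t i j : ℕ} (hi : i < t) (hj : j < t) : i * t + j < t * t := by
  have : (i + 1) * t ≤ t * t := Nat.mul_le_mul_right _ hi
  rw [add_mul, one_mul] at this
  omega

theorem pair_div {t i j : ℕ} (hj : j < t) : (i * t + j) / t = i := by
  rw [mul_comm, Nat.mul_add_div (by omega), Nat.div_eq_of_lt hj, add_zero]

theorem pair_mod {t i j : ℕ} (hj : j < t) : (i * t + j) % t = j := by
  rw [mul_comm, Nat.mul_add_mod, Nat.mod_eq_of_lt hj]

theorem pair_inj {t i j i' j' : ℕ} (hj : j < t) (hj' : j' < t)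
    (h : i * t + j = i' * t + j') : i = i' ∧ j = j' := by
  have h1 := congrArg (· / t) h
  have h2 := congrArg (· % t) h
  simp only [pair_div hj, pair_div hj', pair_mod hj, pair_mod hj'] at h1 h2
  exact ⟨h1, h2⟩

theorem exists_pair {t e : ℕ} (he : e < t * t) : ∃ i < t, ∃ j < t, e = i * t + j := by
  have ht : 0 < t := Nat.pos_of_ne_zero fun h => by simp [h] at he
  exact ⟨e / t, (Nat.div_lt_iff_lt_mul ht).mpr he, e % t, Nat.mod_lt _ ht, (Nat.div_add_mod' e t).symm⟩

/-! ### The adjacency relation of the hard graphs on identifiers -/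

section Rel

variable {t : ℕ} {p q r p' q' r' : ℕ → Prop} {u v w : ℕ}

theorem gadgetRel.lt (ht : 2 ≤ t) (h : gadgetRel t p q r u v) : u < v := by
  unfold gadgetRel at h
  generalize (t + 1) * (t + 1) = m at h
  rcases h with h | h | h | h | h | ⟨i, hi, j, hj, h⟩
  all_goals omega

/-- The smaller node is a hub, or the edge belongs to one of the potential triangles. -/
theorem gadgetRel.hub_or (h : gadgetRel t p q r u v) (ht : 2 ≤ t) :
    u ≤ t ∨ ∃ i < t, ∃ j < t,
      (u = t + 1 + i ∧ v = 2 * t + 1 + j ∧ p (i * t + j)) ∨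
      (u = t + 1 + i ∧ v = 3 * t + 1 + (i * t + j) ∧ q (i * t + j)) ∨
      (u = 2 * t + 1 + j ∧ v = 3 * t + 1 + (i * t + j) ∧ r (i * t + j)) := by
  rcases h with h | h | h | h | h | h
  all_goals first | exact Or.inr h | exact Or.inl (by omega)

/-- Used to show that a node is blind to a bit vector: the implications are demanded only for
endpoints in the blocks concerned, and become vacuous when the node lies elsewhere. -/
theorem gadgetRel.imp (h : gadgetRel t p q r u v)
    (hp : t + 1 ≤ u → u < 2 * t + 1 → 2 * t + 1 ≤ v → v < 3 * t + 1 → ∀ e, p e → p' e)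
    (hq : t + 1 ≤ u → u < 2 * t + 1 → 3 * t + 1 ≤ v → ∀ e, q e → q' e)
    (hr : 2 * t + 1 ≤ u → u < 3 * t + 1 → 3 * t + 1 ≤ v → ∀ e, r e → r' e) :
    gadgetRel t p' q' r' u v := by
  rcases h with h | h | h | h | h | ⟨i, hi, j, hj, h⟩
  · exact Or.inl h
  · exact Or.inr (Or.inl h)
  · exact Or.inr (Or.inr (Or.inl h))
  · exact Or.inr (Or.inr (Or.inr (Or.inl h)))
  · exact Or.inr (Or.inr (Or.inr (Or.inr (Or.inl h))))
  · refine Or.inr (Or.inr (Or.inr (Or.inr (Or.inr ⟨i, hi, j, hj, ?_⟩))))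
    rcases h with ⟨rfl, rfl, h⟩ | ⟨rfl, rfl, h⟩ | ⟨rfl, rfl, h⟩
    · exact Or.inl ⟨rfl, rfl, hp (by omega) (by omega) (by omega) (by omega) _ h⟩
    · exact Or.inr (Or.inl ⟨rfl, rfl, hq (by omega) (by omega) (by omega) _ h⟩)
    · exact Or.inr (Or.inr ⟨rfl, rfl, hr (by omega) (by omega) (by omega) _ h⟩)

/-- The endpoints of a potential edge determine `(i, j)`, so in this lemma and the next two a single
bit decides whether the edge is present. -/
theorem gadgetRel_xy {i j : ℕ} (ht : 2 ≤ t) (hi : i < t) (hj : j < t) :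
    gadgetRel t p q r (t + 1 + i) (2 * t + 1 + j) ↔ p (i * t + j) := by
  constructor
  · intro h
    rcases h.hub_or ht with h | ⟨i', hi', j', hj', h | h | h⟩
    · omega
    · obtain rfl : i = i' := by omega
      obtain rfl : j = j' := by omega
      exact h.2.2
    · omega
    · omega
  · exact fun h => Or.inr (Or.inr (Or.inr (Or.inr (Or.inr ⟨i, hi, j, hj, Or.inl ⟨rfl, rfl, h⟩⟩))))

theorem gadgetRel_xz {i j : ℕ} (ht : 2 ≤ t) (hi : i < t) (hj : j < t) :
    gadgetRel t p q r (t + 1 + i) (3 * t + 1 + (i * t + j)) ↔ q (i * t + j) := by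
  constructor
  · intro h
    rcases h.hub_or ht with h | ⟨i', hi', j', hj', h | h | h⟩
    · omega
    · omega
    · obtain ⟨rfl, rfl⟩ := pair_inj hj hj' (Nat.add_left_cancel h.2.1)
      exact h.2.2
    · omega
  · exact fun h => Or.inr (Or.inr (Or.inr (Or.inr (Or.inr
      ⟨i, hi, j, hj, Or.inr (Or.inl ⟨rfl, rfl, h⟩)⟩))))

theorem gadgetRel_yz {i j : ℕ} (ht : 2 ≤ t) (hi : i < t) (hj : j < t) :
    gadgetRel t p q r (2 * t + 1 + j) (3 * t + 1 + (i * t + j)) ↔ r (i * t + j) := by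
  constructor
  · intro h
    rcases h.hub_or ht with h | ⟨i', hi', j', hj', h | h | h⟩
    · omega
    · omega
    · omega
    · obtain ⟨rfl, rfl⟩ := pair_inj hj hj' (Nat.add_left_cancel h.2.1)
      exact h.2.2
  · exact fun h => Or.inr (Or.inr (Or.inr (Or.inr (Or.inr
      ⟨i, hi, j, hj, Or.inr (Or.inr ⟨rfl, rfl, h⟩)⟩))))

/-- All triangles are potential triangles. -/
theorem gadgetRel_triangle (ht : 2 ≤ t) (huv : gadgetRel t p q r u v)
    (hvw : gadgetRel t p q r v w) (huw : gadgetRel t p q r u w) :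
    ∃ i < t, ∃ j < t, u = t + 1 + i ∧ v = 2 * t + 1 + j ∧ w = 3 * t + 1 + (i * t + j) := by
  have hv : t + 1 ≤ v := by
    unfold gadgetRel at huv
    generalize (t + 1) * (t + 1) = m at huv
    rcases huv with h | h | h | h | h | ⟨i, hi, j, hj, h⟩ <;> omega
  have hm : 0 < (t + 1) * (t + 1) := by positivity
  -- No two hubs are adjacent, so `v` is not a hub and `vw` is a potential edge. If `v` is in `X`,
  -- then `u = 0`, but hub `0` has no neighbours in `Y` or `Z`. If `v` is in `Y`, the only possible
  -- hub is `u = 1`, which has no neighbours in `Z`; so `u` is in `X`.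
  rcases hvw.hub_or ht with h | ⟨i, hi, j, hj, h | h | h⟩
  · omega
  · have h0 : u = 0 := by
      unfold gadgetRel at huv
      rcases huv with h | h | h | h | h | ⟨i', hi', j', hj', h⟩ <;> omega
    subst h0
    unfold gadgetRel at huw
    rcases huw with h | h | h | h | h | ⟨i', hi', j', hj', h⟩ <;> omega
  · have h0 : u = 0 := by
      unfold gadgetRel at huv
      rcases huv with h | h | h | h | h | ⟨i', hi', j', hj', h⟩ <;> omega
    subst h0
    have := pair_lt hi hj
    unfold gadgetRel at huw
    generalize (t + 1) * (t + 1) = m at huw hm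
    generalize t * t = N at huw this
    rcases huw with h | h | h | h | h | ⟨i', hi', j', hj', h⟩ <;> omega
  · have hl := pair_lt hi hj
    have h0 : t + 1 ≤ u := by
      by_contra! hcon
      have h1 : u = 1 := by
        unfold gadgetRel at huv
        rcases huv with h | h | h | h | h | ⟨i', hi', j', hj', h⟩ <;> omega
      unfold gadgetRel at huw
      generalize (t + 1) * (t + 1) = m at huw hm
      generalize t * t = N at huw hl
      rcases huw with h | h | h | h | h | ⟨i', hi', j', hj', h⟩ <;> omega
    rcases huw.hub_or ht with h' | ⟨i', hi', j', hj', h' | h' | h'⟩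
    · omega
    · omega
    · obtain ⟨rfl, rfl⟩ := pair_inj hj hj' (Nat.add_left_cancel (h.2.1.symm.trans h'.2.1))
      exact ⟨i, hi, j, hj, h'.1, h.1, h'.2.1⟩
    · have := huv.lt ht
      rcases huv.hub_or ht with h'' | ⟨i'', hi'', j'', hj'', h'' | h'' | h''⟩ <;> omega

/-- Every node has at most `t + 1` smaller neighbours. -/
theorem gadgetRel_smaller_card (ht : 2 ≤ t) (p q r : ℕ → Prop) (v : ℕ) :
    ∃ s : Finset ℕ, s.card ≤ t + 1 ∧ ∀ u, gadgetRel t p q r u v → u ∈ s := by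
  have hN : ∀ {i j}, i < t → j < t → i * t + j < t * t := fun hi hj => pair_lt hi hj
  -- Block by block, the smaller neighbours are: at most hub `0` for hubs and `X`; hub `1` and `X`
  -- for `Y`; hub `2` with one node each of `X` and `Y` for `Z`, where `2 ≤ t` gives `3 ≤ t + 1`;
  -- only hubs for all later nodes.
  rcases Nat.lt_or_ge v (2 * t + 1) with h1 | h1
  · refine ⟨{0}, by simp, fun u h => ?_⟩
    rw [Finset.mem_singleton]
    unfold gadgetRel at h
    rcases h with h | h | h | h | h | ⟨i, hi, j, hj, h⟩ <;> omega
  rcases Nat.lt_or_ge v (3 * t + 1) with h2 | h2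
  · refine ⟨insert 1 (Finset.Ico (t + 1) (2 * t + 1)), ?_, fun u h => ?_⟩
    · refine (Finset.card_insert_le _ _).trans ?_
      rw [Nat.card_Ico]
      omega
    · rw [Finset.mem_insert, Finset.mem_Ico]
      unfold gadgetRel at h
      rcases h with h | h | h | h | h | ⟨i, hi, j, hj, h⟩ <;> omega
  rcases Nat.lt_or_ge v (3 * t + 1 + t * t) with h3 | h3
  · obtain ⟨i, hi, j, hj, he⟩ := exists_pair (t := t) (e := v - (3 * t + 1)) (by omega)
    refine ⟨{2, t + 1 + i, 2 * t + 1 + j}, Finset.card_le_three.trans (by omega), fun u h => ?_⟩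
    simp only [Finset.mem_insert, Finset.mem_singleton]
    unfold gadgetRel at h
    rcases h with h | h | h | h | h | ⟨i', hi', j', hj', h | h | h⟩
    all_goals try omega
    · obtain ⟨rfl, rfl⟩ := pair_inj hj hj' (by omega : i * t + j = i' * t + j')
      omega
    · obtain ⟨rfl, rfl⟩ := pair_inj hj hj' (by omega : i * t + j = i' * t + j')
      omega
  · refine ⟨Finset.range (t + 1), by simp, fun u h => ?_⟩
    rw [Finset.mem_range]
    rcases h.hub_or ht with h | ⟨i, hi, j, hj, h⟩
    · omega
    · have := hN hi hj
      generalize t * t = N at *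
      generalize i * t + j = e at *
      omega

end Rel

/-- The hard graph on `n` nodes with the parameters `t`, `p`, `q`, `r`. -/
def gadgetGraph (n t : ℕ) (ht : 2 ≤ t) (p q r : ℕ → Prop) : SimpleGraph (Fin n) where
  Adj u v := gadgetRel t p q r u v ∨ gadgetRel t p q r v u
  symm := ⟨fun _ _ h => h.symm⟩
  loopless := ⟨fun _ h => h.elim (fun h => (h.lt ht).false) fun h => (h.lt ht).false⟩

/-! ### Connectivity, arboricity and triangles of the hard graphs -/

section Graph

variable {n t : ℕ} {ht : 2 ≤ t} {p q r : ℕ → Prop}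

theorem gadgetGraph_adj_of_lt {u v : Fin n} (h : u < v) :
    (gadgetGraph n t ht p q r).Adj u v ↔ gadgetRel t p q r u v :=
  ⟨fun h' => h'.elim id fun h'' => absurd (h''.lt ht) (by simpa using h.le), Or.inl⟩

/-- The hubs are connected through the first node `w₀` of `W`, and every other node is adjacent to
one of the hubs `0`, `1`, `2`. -/
theorem gadgetGraph_connected (hn : 3 * t + 1 + t * t + (t + 1) * (t + 1) ≤ n) :
    (gadgetGraph n t ht p q r).Connected := by
  set m := (t + 1) * (t + 1) with hm
  have hm0 : 0 < m := by positivity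
  set w₀ := 3 * t + 1 + t * t with hw₀
  have step : ∀ {u v : ℕ} (hu : u < n) (hv : v < n), gadgetRel t p q r u v →
      (gadgetGraph n t ht p q r).Reachable ⟨v, hv⟩ ⟨u, hu⟩ :=
    fun hu hv h => SimpleGraph.Adj.reachable (Or.inr h)
  have hw : (gadgetGraph n t ht p q r).Reachable ⟨w₀, by omega⟩ ⟨0, by omega⟩ :=
    step _ _ (Or.inl ⟨by omega, le_rfl, by omega⟩)
  have hhub : ∀ (u : ℕ) (hu : u ≤ t),
      (gadgetGraph n t ht p q r).Reachable ⟨u, by omega⟩ ⟨0, by omega⟩ := fun u hu =>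
    (step (u := u) (v := w₀) (by omega) (by omega)
      (Or.inl ⟨hu, le_rfl, by omega⟩)).symm.trans hw
  have hall : ∀ (v : ℕ) (hv : v < n),
      (gadgetGraph n t ht p q r).Reachable ⟨v, hv⟩ ⟨0, by omega⟩ := by
    intro v hv
    rcases Nat.lt_or_ge v (t + 1) with h1 | h1
    · exact hhub v (by omega)
    rcases Nat.lt_or_ge v (2 * t + 1) with h2 | h2
    · exact step _ _ (Or.inr (Or.inr (Or.inl ⟨rfl, h1, h2⟩)))
    rcases Nat.lt_or_ge v (3 * t + 1) with h3 | h3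
    · exact (step (by omega) hv (Or.inr (Or.inr (Or.inr (Or.inl ⟨rfl, h2, h3⟩))))).trans
        (hhub 1 (by omega))
    rcases Nat.lt_or_ge v w₀ with h4 | h4
    · exact (step (by omega) hv (Or.inr (Or.inr (Or.inr (Or.inr (Or.inl ⟨rfl, h3, h4⟩)))))).trans
        (hhub 2 (by omega))
    rcases Nat.lt_or_ge v (w₀ + m) with h5 | h5
    · exact step _ _ (Or.inl ⟨by omega, h4, h5⟩)
    · exact step _ _ (Or.inr (Or.inl ⟨rfl, h5⟩))
  have : Nonempty (Fin n) := ⟨⟨0, by omega⟩⟩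
  exact ⟨fun u v => (hall u u.isLt).trans (hall v v.isLt).symm⟩

/-- The complete bipartite graph between hubs and `W` has `(t + 1) ^ 3` edges, while `t` forests on
its vertices have at most `t * (t ^ 2 + 3 * t + 1)`, which is smaller by `2 * t + 1`. The upper
bound comes from the order of the identifiers. -/
theorem gadgetGraph_arboricity (hn : 3 * t + 1 + t * t + (t + 1) * (t + 1) ≤ n) :
    arboricity (gadgetGraph n t ht p q r) = t + 1 := by
  let f : Fin (t + 1) ⊕ Fin ((t + 1) * (t + 1)) ↪ Fin n :=
    ⟨Sum.elim (fun i => ⟨i, by omega⟩) fun k => ⟨3 * t + 1 + t * t + k, by omega⟩, by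
      rintro (i | i) (j | j) h <;> simp only [Sum.elim_inl, Sum.elim_inr, Fin.mk.injEq] at h
      · rw [Fin.ext h]
      · omega
      · omega
      · rw [Fin.ext (Nat.add_left_cancel h)]⟩
  refine arboricity_eq _ _ (fun v => ?_) f ?_
  · obtain ⟨s, hs, hv⟩ := gadgetRel_smaller_card ht p q r v
    rw [← Set.ncard_image_of_injective _ Fin.val_injective]
    refine le_trans ?_ hs
    rw [← Set.ncard_coe_finset]
    refine Set.ncard_le_ncard ?_ s.finite_toSet
    rintro _ ⟨u, ⟨hlt, hadj⟩, rfl⟩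
    exact hv u ((gadgetGraph_adj_of_lt hlt).mp hadj.symm)
  · let g : Fin (t + 1) × Fin ((t + 1) * (t + 1)) →
        Sym2 (Fin (t + 1) ⊕ Fin ((t + 1) * (t + 1))) := fun w => s(Sum.inl w.1, Sum.inr w.2)
    have hg : Function.Injective g := by
      rintro ⟨i, k⟩ ⟨i', k'⟩ h
      simpa [g] using h
    have hsub : Set.range g ⊆ ((gadgetGraph n t ht p q r).comap f).edgeSet := by
      rintro _ ⟨⟨i, k⟩, rfl⟩
      refine Or.inl (Or.inl ⟨?_, ?_, ?_⟩)
      · show (i : ℕ) ≤ t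
        omega
      · exact Nat.le_add_right _ _
      · exact Nat.add_lt_add_left k.isLt _
    have hcard := Set.ncard_le_ncard hsub (Set.toFinite _)
    rw [← Set.image_univ, Set.ncard_image_of_injective _ hg, Set.ncard_univ, Nat.card_eq_fintype_card,
      Fintype.card_prod, Fintype.card_fin, Fintype.card_fin] at hcard
    refine lt_of_lt_of_le ?_ hcard
    rw [Fintype.card_sum, Fintype.card_fin, Fintype.card_fin]
    have : t + 1 + (t + 1) * (t + 1) - 1 = t * t + 3 * t + 1 := by
      have : (t + 1) * (t + 1) = t * t + 2 * t + 1 := by ring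
      omega
    rw [this]
    have : (t + 1) * ((t + 1) * (t + 1)) = t * (t * t + 3 * t + 1) + (2 * t + 1) := by ring
    simp only [Nat.add_sub_cancel]
    omega

/-- The corners of the potential triangle number `e`. -/
def potentialTriangle (t e : ℕ) : OutItem := [t + 1 + e / t, 2 * t + 1 + e % t, 3 * t + 1 + e]

theorem potentialTriangle_injective (t : ℕ) : Function.Injective (potentialTriangle t) := by
  intro e e' h
  simp only [potentialTriangle, List.cons.injEq] at h
  omega

/-- The triangles of the hard graph. -/
theorem mem_triangleItems_gadgetGraph (hn : 3 * t + 1 + t * t + (t + 1) * (t + 1) ≤ n)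
    {x : OutItem} : x ∈ triangleItems (gadgetGraph n t ht p q r) ↔
      ∃ e < t * t, x = potentialTriangle t e ∧ p e ∧ q e ∧ r e := by
  simp only [triangleItems, Finset.mem_image, Finset.mem_filter, Finset.mem_univ, true_and,
    Prod.exists]
  constructor
  · rintro ⟨u, v, w, ⟨huv, hvw, h1, h2, h3⟩, rfl⟩
    rw [gadgetGraph_adj_of_lt huv] at h1
    rw [gadgetGraph_adj_of_lt hvw] at h2
    rw [gadgetGraph_adj_of_lt (huv.trans hvw)] at h3
    obtain ⟨i, hi, j, hj, hu, hv, hw⟩ := gadgetRel_triangle ht h1 h2 h3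
    rw [hu, hv, gadgetRel_xy ht hi hj] at h1
    rw [hv, hw, gadgetRel_yz ht hi hj] at h2
    rw [hu, hw, gadgetRel_xz ht hi hj] at h3
    refine ⟨i * t + j, pair_lt hi hj, ?_, h1, h3, h2⟩
    rw [potentialTriangle, pair_div hj, pair_mod hj, hu, hv, hw]
  · rintro ⟨e, he, rfl, hp, hq, hr⟩
    obtain ⟨i, hi, j, hj, rfl⟩ := exists_pair he
    refine ⟨⟨t + 1 + i, by omega⟩, ⟨2 * t + 1 + j, by omega⟩, ⟨3 * t + 1 + (i * t + j), by omega⟩,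
      ⟨Fin.mk_lt_mk.mpr (by omega), Fin.mk_lt_mk.mpr (by omega),
        Or.inl ((gadgetRel_xy ht hi hj).mpr hp), Or.inl ((gadgetRel_yz ht hi hj).mpr hr),
        Or.inl ((gadgetRel_xz ht hi hj).mpr hq)⟩, ?_⟩
    simp only [potentialTriangle, pair_div hj, pair_mod hj]

end Graph

/-! ### The round lower bound on the hard graphs -/

theorem atNode_eq_of_unlabeled {n : ℕ} {I I' : GraphInput n 0} {v : Fin n}
    (h : I.graph.neighborSet v = I'.graph.neighborSet v) : I.atNode v = I'.atNode v := by
  have key : ∀ a b : NodeInput n 0, a.neighbours = b.neighbours → a = b := by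
    rintro ⟨s, l, e⟩ ⟨s', l', e'⟩ hs
    cases hs
    congr 1
    · exact Subsingleton.elim _ _
    · exact Subsingleton.elim _ _
  exact key _ _ h

/-- A bit vector as a predicate on the natural numbers. -/
def bitPredicate {N : ℕ} (f : Fin N → Bool) (e : ℕ) : Prop := ∃ h : e < N, f ⟨e, h⟩ = true

/-- Listing the triangles of the hard graphs takes `Ω(t / (C log n))` rounds with capacity `C`. -/
theorem NCCAlgorithm.Solves.gadget_le {κ n t : ℕ} {hκ : 2 ≤ κ} {ht : 2 ≤ t}
    (hn : 3 * t + 1 + t * t + (t + 1) * (t + 1) ≤ n)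
    {𝒢 : (n : ℕ) → Set (SimpleGraph (Fin n))} (h𝒢 : ∀ p q r, gadgetGraph n t ht p q r ∈ 𝒢 n)
    {A : NCCAlgorithm n (triangleListing κ hκ 𝒢).labelWords} {C T β : ℕ}
    (hA : A.Solves (triangleListing κ hκ 𝒢) C T β) :
    t ≤ 96 * (((κ + 1) * Nat.size n + 1) * C * T) := by
  classical
  let I : (Fin (t * t) → Bool) → (Fin (t * t) → Bool) → (Fin (t * t) → Bool) →
      GraphInput n (triangleListing κ hκ 𝒢).labelWords := fun p q r =>
    ⟨gadgetGraph n t ht (bitPredicate p) (bitPredicate q) (bitPredicate r),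
      fun _ _ => 0, fun _ _ => 0⟩
  let X : Finset (Fin n) := Finset.univ.filter fun v => t + 1 ≤ (v : ℕ) ∧ (v : ℕ) < 2 * t + 1
  let Y : Finset (Fin n) := Finset.univ.filter fun v => 2 * t + 1 ≤ (v : ℕ) ∧ (v : ℕ) < 3 * t + 1
  have hX : ∀ v, v ∈ X ↔ t + 1 ≤ (v : ℕ) ∧ (v : ℕ) < 2 * t + 1 := by simp [X]
  have hY : ∀ v, v ∈ Y ↔ 2 * t + 1 ≤ (v : ℕ) ∧ (v : ℕ) < 3 * t + 1 := by simp [Y]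
  have hXY : (X ∪ Y).card ≤ 2 * t := by
    have : ((X ∪ Y).map Fin.valEmbedding).card ≤ (Finset.Ico (t + 1) (3 * t + 1)).card := by
      refine Finset.card_le_card fun k hk => ?_
      obtain ⟨v, hv, rfl⟩ := Finset.mem_map.mp hk
      rw [Finset.mem_union, hX, hY] at hv
      rw [Finset.mem_Ico, Fin.valEmbedding_apply]
      omega
    rw [Finset.card_map, Nat.card_Ico] at this
    omega
  have hsymm : ∀ {p q r p' q' r' : Fin (t * t) → Bool} {v : Fin n},
      (∀ u : ℕ, (gadgetRel t (bitPredicate p) (bitPredicate q) (bitPredicate r) v u ↔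
        gadgetRel t (bitPredicate p') (bitPredicate q') (bitPredicate r') v u) ∧
        (gadgetRel t (bitPredicate p) (bitPredicate q) (bitPredicate r) u v ↔
        gadgetRel t (bitPredicate p') (bitPredicate q') (bitPredicate r') u v)) →
      (I p q r).atNode v = (I p' q' r').atNode v := by
    intro p q r p' q' r' v h
    refine atNode_eq_of_unlabeled (Set.ext fun u => ?_)
    exact or_congr (h u).1 (h u).2
  have hmain := hA.card_le I (fun p q r => h𝒢 _ _ _) X Y ?_ ?_ ?_
    (fun e => potentialTriangle t e) ?_
  · rw [Fintype.card_fin] at hmain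
    set D := ((κ + 1) * Nat.size n + 1) * C
    -- There are `t * t` positions but only `2 * t` nodes in `X ∪ Y`, so a factor `t` cancels; `96 =
    -- 24 * 2 * 2`.
    have h1 : t * t ≤ (96 * (D * T)) * t := by
      calc t * t ≤ 24 * (D * (2 * ((X ∪ Y).card * T))) := hmain
        _ ≤ 24 * (D * (2 * (2 * t * T))) := by gcongr
        _ = _ := by ring
    exact Nat.le_of_mul_le_mul_right h1 (by omega)
  -- In this and the next two goals only one vector changes, and no edge at `v` depends on it; the
  -- corresponding hypothesis of `gadgetRel.imp` is vacuous.
  · intro p p' q r v hv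
    rw [Finset.mem_union, hX, hY] at hv
    refine hsymm fun u => ⟨⟨fun h => ?_, fun h => ?_⟩, ⟨fun h => ?_, fun h => ?_⟩⟩ <;>
      refine h.imp ?_ (fun _ _ _ _ => id) (fun _ _ _ _ => id) <;> intros <;> omega
  · intro p q q' r v hv
    rw [hY] at hv
    refine hsymm fun u => ⟨⟨fun h => ?_, fun h => ?_⟩, ⟨fun h => ?_, fun h => ?_⟩⟩ <;>
      refine h.imp (fun _ _ _ _ _ => id) ?_ (fun _ _ _ _ => id) <;> intros <;> omega
  · intro p q r r' v hv
    rw [hX] at hv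
    refine hsymm fun u => ⟨⟨fun h => ?_, fun h => ?_⟩, ⟨fun h => ?_, fun h => ?_⟩⟩ <;>
      refine h.imp (fun _ _ _ _ _ => id) (fun _ _ _ _ => id) ?_ <;> intros <;> omega
  · intro p q r s hs e
    rw [Set.mem_singleton_iff.mp hs, mem_triangleItems_gadgetGraph hn]
    constructor
    · rintro ⟨e', he', h, ⟨_, h1⟩, ⟨_, h2⟩, ⟨_, h3⟩⟩
      have := potentialTriangle_injective t h
      subst this
      exact ⟨h1, h2, h3⟩
    · rintro ⟨h1, h2, h3⟩
      exact ⟨e, e.isLt, rfl, ⟨e.isLt, h1⟩, ⟨e.isLt, h2⟩, e.isLt, h3⟩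

/-! ### The program for massively parallel computation -/

/-- The base `2 ^ Nat.size n` of the encoding of edges, by primitive recursion. -/
def idBase (n : ℕ) : ℕ := Nat.rec 1 (fun _ b => if b ≤ n then 2 * b else b) n

/-- The recursion doubles until it exceeds `n`, so it is `2 ^ min k (Nat.size n)` after `k` steps;
`n` steps are enough because `Nat.size n ≤ n`. -/
theorem idBase_eq (n : ℕ) : idBase n = 2 ^ Nat.size n := by
  have key : ∀ k : ℕ, (Nat.rec 1 (fun _ b => if b ≤ n then 2 * b else b) k : ℕ)
      = 2 ^ min k (Nat.size n) := by
    intro k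
    induction k with
    | zero => simp
    | succ k ih =>
      show (if (Nat.rec 1 (fun _ b => if b ≤ n then 2 * b else b) k : ℕ) ≤ n then _ else _) = _
      rw [ih]
      split_ifs with h
      · have h1 : k < Nat.size n := by
          by_contra! hk
          rw [min_eq_right hk] at h
          exact absurd (Nat.lt_size_self n) (by omega)
        rw [min_eq_left h1.le, min_eq_left h1, pow_succ, mul_comm]
      · have h1 : Nat.size n ≤ min k (Nat.size n) := Nat.size_le.mpr (by omega)
        have h2 : Nat.size n ≤ k := h1.trans (min_le_left _ _)
        rw [min_eq_right h2, min_eq_right (h2.trans (Nat.le_succ k))]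
  rw [idBase, key, min_eq_right (Nat.size_le.mpr Nat.lt_two_pow_self)]

theorem primrec_idBase : Primrec idBase := by
  have hg : Primrec₂ fun (n : ℕ) (w : ℕ × ℕ) => if w.2 ≤ n then 2 * w.2 else w.2 := by
    have h2 : Primrec fun w : ℕ × (ℕ × ℕ) => w.2.2 := Primrec.snd.comp Primrec.snd
    exact Primrec.ite (Primrec.nat_le.comp h2 Primrec.fst)
      (Primrec.nat_mul.comp (Primrec.const 2) h2) h2
  have h := Primrec.nat_rec (f := fun _ : ℕ => 1) (Primrec.const 1) hg
  exact h.comp Primrec.id Primrec.id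

/-- The destination of the word `w` of an edge: if the edge belongs to the potential triangle
number `e`, then it is sent to machine `e / s`. All other edges are dropped. -/
def routeEdge (B t s w : ℕ) : Option (ℕ × ℕ) :=
  if t + 1 ≤ w / B then
    some ((if w % B < 3 * t + 1 then (w / B - (t + 1)) * t + (w % B - (2 * t + 1))
      else w % B - (3 * t + 1)) / s, w)
  else none

/-- Report the potential triangle number `e` if the words of its three edges have arrived. -/
def reportTriangle (B t : ℕ) (inbox : List (ℕ × ℕ)) (e : ℕ) : Option OutItem :=
  if e < t * t ∧ (∃ m ∈ inbox, m.2 = (t + 1 + e / t) * B + (2 * t + 1 + e % t)) ∧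
      (∃ m ∈ inbox, m.2 = (t + 1 + e / t) * B + (3 * t + 1 + e)) ∧
      (∃ m ∈ inbox, m.2 = (2 * t + 1 + e % t) * B + (3 * t + 1 + e)) then
    some (potentialTriangle t e)
  else none

/-! ### Primitive recursiveness of routing and reporting -/

section Primrec

variable {α : Type*} [Primcodable α] {B t s w : α → ℕ}

theorem primrec_routeEdge (hB : Primrec B) (ht : Primrec t) (hs : Primrec s) (hw : Primrec w) :
    Primrec fun x => routeEdge (B x) (t x) (s x) (w x) := by
  have c : ∀ k : ℕ, Primrec fun _ : α => k := Primrec.const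
  have add {f g : α → ℕ} (hf : Primrec f) (hg : Primrec g) : Primrec fun x => f x + g x :=
    Primrec.nat_add.comp hf hg
  have mul {f g : α → ℕ} (hf : Primrec f) (hg : Primrec g) : Primrec fun x => f x * g x :=
    Primrec.nat_mul.comp hf hg
  have sub {f g : α → ℕ} (hf : Primrec f) (hg : Primrec g) : Primrec fun x => f x - g x :=
    Primrec.nat_sub.comp hf hg
  have hu : Primrec fun x => w x / B x := Primrec.nat_div.comp hw hB
  have hv : Primrec fun x => w x % B x := Primrec.nat_mod.comp hw hB
  have h2 := add (mul (c 2) ht) (c 1)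
  have h3 := add (mul (c 3) ht) (c 1)
  exact Primrec.ite (Primrec.nat_le.comp (add ht (c 1)) hu)
    (Primrec.option_some.comp (Primrec.pair (Primrec.nat_div.comp
      (Primrec.ite (Primrec.nat_lt.comp hv h3)
        (add (mul (sub hu (add ht (c 1))) ht) (sub hv h2)) (sub hv h3)) hs) hw))
    (Primrec.const none)

theorem primrec_reportTriangle {inbox : α → List (ℕ × ℕ)} {e : α → ℕ} (hB : Primrec B)
    (ht : Primrec t) (hi : Primrec inbox) (he : Primrec e) :
    Primrec fun x => reportTriangle (B x) (t x) (inbox x) (e x) := by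
  have c : ∀ k : ℕ, Primrec fun _ : α => k := Primrec.const
  have add {f g : α → ℕ} (hf : Primrec f) (hg : Primrec g) : Primrec fun x => f x + g x :=
    Primrec.nat_add.comp hf hg
  have mul {f g : α → ℕ} (hf : Primrec f) (hg : Primrec g) : Primrec fun x => f x * g x :=
    Primrec.nat_mul.comp hf hg
  have hmem {f : α → ℕ} (hf : Primrec f) : PrimrecPred fun x => ∃ m ∈ inbox x, m.2 = f x := by
    have hR : PrimrecRel fun (m : ℕ × ℕ) (k : ℕ) => m.2 = k :=
      Primrec.eq.comp (Primrec.snd.comp Primrec.fst) Primrec.snd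
    exact hR.exists_mem_list.comp hi hf
  have hx := add (add ht (c 1)) (Primrec.nat_div.comp he ht)
  have hy := add (add (mul (c 2) ht) (c 1)) (Primrec.nat_mod.comp he ht)
  have hz := add (add (mul (c 3) ht) (c 1)) he
  have hitem : Primrec fun x => potentialTriangle (t x) (e x) :=
    Primrec.list_cons.comp hx (Primrec.list_cons.comp hy
      (Primrec.list_cons.comp hz (Primrec.const [])))
  exact Primrec.ite ((Primrec.nat_lt.comp he (mul ht ht)).and
      ((hmem (add (mul hx hB) hy)).and ((hmem (add (mul hx hB) hz)).and
        (hmem (add (mul hy hB) hz)))))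
    (Primrec.option_some.comp hitem) (Primrec.const none)

end Primrec

/-- In the first round every machine sends the edges of the potential triangles to the machines
responsible for them; then every machine reports the triangles it is responsible for. -/
def triangleProgram : MPCAlgorithm where
  -- Here `v.1.1.2.2.2 - 1` is `t`, and `v.1.1.2.2.1 / 3` is the number of potential triangles per
  -- machine: each takes three words of the inbox, and three words of output.
  step v := ([], v.2.1.filterMap
    (routeEdge (idBase v.1.1.1) (v.1.1.2.2.2 - 1) (v.1.1.2.2.1 / 3)))
  out v := (List.range (v.1.1.2.2.1 / 3)).filterMap fun k =>
    reportTriangle (idBase v.1.1.1) (v.1.1.2.2.2 - 1) v.2.2 (v.1.2.1 * (v.1.1.2.2.1 / 3) + k)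
  step_computable := by
    have h0 : Primrec fun v : MachineView => v.1.1 := Primrec.fst.comp Primrec.fst
    have hB : Primrec fun v : MachineView => idBase v.1.1.1 :=
      primrec_idBase.comp (Primrec.fst.comp h0)
    have ht : Primrec fun v : MachineView => v.1.1.2.2.2 - 1 :=
      Primrec.nat_sub.comp (Primrec.snd.comp (Primrec.snd.comp (Primrec.snd.comp h0)))
        (Primrec.const 1)
    have hs : Primrec fun v : MachineView => v.1.1.2.2.1 / 3 :=
      Primrec.nat_div.comp (Primrec.fst.comp (Primrec.snd.comp (Primrec.snd.comp h0)))
        (Primrec.const 3)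
    have hr := primrec_routeEdge (hB.comp (Primrec.fst (β := ℕ))) (ht.comp Primrec.fst)
      (hs.comp Primrec.fst) Primrec.snd
    exact (Primrec.pair (Primrec.const [])
      (Primrec.listFilterMap (Primrec.fst.comp Primrec.snd) hr.to₂)).to_comp
  out_computable := by
    have h0 : Primrec fun v : MachineView => v.1.1 := Primrec.fst.comp Primrec.fst
    have hB : Primrec fun v : MachineView => idBase v.1.1.1 :=
      primrec_idBase.comp (Primrec.fst.comp h0)
    have ht : Primrec fun v : MachineView => v.1.1.2.2.2 - 1 :=
      Primrec.nat_sub.comp (Primrec.snd.comp (Primrec.snd.comp (Primrec.snd.comp h0)))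
        (Primrec.const 1)
    have hs : Primrec fun v : MachineView => v.1.1.2.2.1 / 3 :=
      Primrec.nat_div.comp (Primrec.fst.comp (Primrec.snd.comp (Primrec.snd.comp h0)))
        (Primrec.const 3)
    have hi : Primrec fun v : MachineView => v.1.2.1 :=
      Primrec.fst.comp (Primrec.snd.comp Primrec.fst)
    have hin : Primrec fun v : MachineView => v.2.2 := Primrec.snd.comp Primrec.snd
    have hr := primrec_reportTriangle (hB.comp (Primrec.fst (β := ℕ))) (ht.comp Primrec.fst)
      (hin.comp Primrec.fst)
      (Primrec.nat_add.comp ((Primrec.nat_mul.comp hi hs).comp Primrec.fst) Primrec.snd)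
    exact (Primrec.listFilterMap (Primrec.list_range.comp hs) hr.to₂).to_comp

/-! ### Correctness of the program -/

/-- The word that represents an edge. -/
def edgeWord {n : ℕ} (e : Fin n × Fin n) : ℕ := (e.1 : ℕ) * 2 ^ Nat.size n + (e.2 : ℕ)

theorem edgeWord_div {n : ℕ} (e : Fin n × Fin n) : edgeWord e / 2 ^ Nat.size n = e.1 := by
  have h : (e.2 : ℕ) < 2 ^ Nat.size n := e.2.isLt.trans (Nat.lt_size_self n)
  rw [edgeWord, mul_comm, Nat.mul_add_div (by positivity), Nat.div_eq_of_lt h, add_zero]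

theorem edgeWord_mod {n : ℕ} (e : Fin n × Fin n) : edgeWord e % 2 ^ Nat.size n = e.2 := by
  have h : (e.2 : ℕ) < 2 ^ Nat.size n := e.2.isLt.trans (Nat.lt_size_self n)
  rw [edgeWord, mul_comm, Nat.mul_add_mod, Nat.mod_eq_of_lt h]

theorem edgeWord_injective {n : ℕ} : Function.Injective (edgeWord (n := n)) := by
  intro e e' h
  refine Prod.ext (Fin.ext ?_) (Fin.ext ?_)
  · rw [← edgeWord_div e, ← edgeWord_div e', h]
  · rw [← edgeWord_mod e, ← edgeWord_mod e', h]

theorem edgeWord_lt {κ n : ℕ} (hκ : 2 ≤ κ) (e : Fin n × Fin n) : edgeWord e < wordBound κ n := by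
  have h1 : (e.1 : ℕ) + 1 ≤ 2 ^ Nat.size n := e.1.isLt.trans (Nat.lt_size_self n)
  have h2 : (e.2 : ℕ) < 2 ^ Nat.size n := e.2.isLt.trans (Nat.lt_size_self n)
  calc edgeWord e < ((e.1 : ℕ) + 1) * 2 ^ Nat.size n := by rw [edgeWord, add_mul, one_mul]; omega
    _ ≤ 2 ^ Nat.size n * 2 ^ Nat.size n := Nat.mul_le_mul_right _ h1
    _ = 2 ^ (2 * Nat.size n) := by rw [two_mul, pow_add]
    _ ≤ wordBound κ n := Nat.pow_le_pow_right (by norm_num) (Nat.mul_le_mul_right _ hκ)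

theorem flatMap_edgeRecord_unlabeled {n : ℕ} (I : GraphInput n 0) (l : List (Fin n × Fin n)) :
    l.flatMap (edgeRecord I) = l.map edgeWord := by
  rw [List.map_eq_flatMap]
  refine List.flatMap_congr fun e _ => ?_
  simp [edgeRecord, edgeWord]

theorem routeEdge_eq_some {B t s w : ℕ} {m : ℕ × ℕ} (h : routeEdge B t s w = some m) :
    t + 1 ≤ w / B ∧ m.2 = w := by
  unfold routeEdge at h
  split_ifs at h with h1 <;> simp only [Option.some.injEq] at h <;> subst h <;> exact ⟨h1, rfl⟩

/-- The three edges of the potential triangle number `e`, as pairs of identifiers. -/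
def IsCoreEdge (t e u v : ℕ) : Prop :=
  (u = t + 1 + e / t ∧ v = 2 * t + 1 + e % t) ∨ (u = t + 1 + e / t ∧ v = 3 * t + 1 + e) ∨
    (u = 2 * t + 1 + e % t ∧ v = 3 * t + 1 + e)

theorem gadgetRel.exists_isCoreEdge {t : ℕ} {p q r : ℕ → Prop} {u v : ℕ}
    (h : gadgetRel t p q r u v) (ht : 2 ≤ t) (hu : t + 1 ≤ u) :
    ∃ e < t * t, IsCoreEdge t e u v := by
  rcases h.hub_or ht with h | ⟨i, hi, j, hj, h⟩
  · omega
  · refine ⟨i * t + j, pair_lt hi hj, ?_⟩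
    rw [IsCoreEdge, pair_div hj, pair_mod hj]
    rcases h with h | h | h
    · exact Or.inl ⟨h.1, h.2.1⟩
    · exact Or.inr (Or.inl ⟨h.1, h.2.1⟩)
    · exact Or.inr (Or.inr ⟨h.1, h.2.1⟩)

/-- An edge ending in `Z` carries the number `e` in that endpoint, and an edge from `X` to `Y`
carries its two digits in base `t`; comparing the larger endpoint with `3 * t + 1` tells the cases
apart. -/
theorem routeEdge_core {n t s e : ℕ} (he : e < t * t) {w : Fin n × Fin n}
    (h : IsCoreEdge t e w.1 w.2) :
    routeEdge (2 ^ Nat.size n) t s (edgeWord w) = some (e / s, edgeWord w) := by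
  have ht : 0 < t := Nat.pos_of_ne_zero fun h => by simp [h] at he
  have hm : e % t < t := Nat.mod_lt _ ht
  have hu : t + 1 ≤ (w.1 : ℕ) := by
    unfold IsCoreEdge at h
    generalize e / t = d at h
    generalize e % t = m at h
    rcases h with h | h | h <;> omega
  rw [routeEdge, edgeWord_div, edgeWord_mod, if_pos hu]
  congr 3
  rcases h with ⟨h1, h2⟩ | ⟨h1, h2⟩ | ⟨h1, h2⟩
  · rw [if_pos (by omega), h1, h2, Nat.add_sub_cancel_left, Nat.add_sub_cancel_left,
      Nat.div_add_mod']
  · rw [if_neg (by omega), h2, Nat.add_sub_cancel_left]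
  · rw [if_neg (by omega), h2, Nat.add_sub_cancel_left]

section Correctness

variable {n t M s : ℕ} {ht : 2 ≤ t} {p q r : ℕ → Prop} {x : Fin M → List (Fin n × Fin n)}

/-- What machine `i` sends in the first round. -/
def routed (t s : ℕ) (x : Fin M → List (Fin n × Fin n)) (i : Fin M) : List (ℕ × ℕ) :=
  ((x i).map edgeWord).filterMap (routeEdge (2 ^ Nat.size n) t s)

theorem mem_routed {i : Fin M} {m : ℕ × ℕ}
    (hx : ∀ e ∈ x i, e.1 < e.2 ∧ (gadgetGraph n t ht p q r).Adj e.1 e.2) :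
    m ∈ routed t s x i ↔
      ∃ w ∈ x i, ∃ e < t * t, IsCoreEdge t e w.1 w.2 ∧ m = (e / s, edgeWord w) := by
  simp only [routed, List.mem_filterMap, List.mem_map]
  constructor
  · rintro ⟨_, ⟨w, hw, rfl⟩, h⟩
    have h1 := (routeEdge_eq_some h).1
    rw [edgeWord_div] at h1
    obtain ⟨e, he, hc⟩ :=
      ((gadgetGraph_adj_of_lt (hx w hw).1).mp (hx w hw).2).exists_isCoreEdge ht h1
    rw [routeEdge_core he hc, Option.some.injEq] at h
    exact ⟨w, hw, e, he, hc, h.symm⟩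
  · rintro ⟨w, hw, e, he, hc, rfl⟩
    exact ⟨_, ⟨w, hw, rfl⟩, routeEdge_core he hc⟩

/-- Each edge is stored once and causes at most one message. Hence the length of an inbox can be
bounded by counting distinct words. -/
theorem deliver_map_snd_nodup (hnodup : (List.ofFn x).flatten.Nodup) (i : Fin M) :
    ((deliver (routed t s x) i).map Prod.snd).Nodup := by
  have h1 : (deliver (routed t s x) i).map Prod.snd
      = (List.finRange M).flatMap fun j =>
          ((routed t s x j).filter fun msg => msg.1 = (i : ℕ)).map Prod.snd := by
    simp [deliver, List.map_flatMap, Function.comp_def]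
  have h2 : ∀ l : List ℕ,
      ((l.filterMap (routeEdge (2 ^ Nat.size n) t s)).map Prod.snd).Sublist l := by
    intro l
    induction l with
    | nil => simp
    | cons w l ih =>
      rw [List.filterMap_cons]
      rcases h : routeEdge (2 ^ Nat.size n) t s w with _ | m
      · exact ih.cons w
      · rw [List.map_cons, (routeEdge_eq_some h).2]
        exact ih.cons_cons w
  have h3 : ((deliver (routed t s x) i).map Prod.snd).Sublist
      ((List.finRange M).flatMap fun j => (x j).map edgeWord) := by
    rw [h1]
    exact List.Sublist.flatMap_right _ fun j _ =>
      ((List.filter_sublist).map Prod.snd).trans (h2 _)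
  refine h3.nodup ?_
  rw [← List.map_flatMap]
  refine List.Nodup.map edgeWord_injective ?_
  rwa [List.ofFn_eq_map, ← List.flatMap_def] at hnodup

variable (hnodup : (List.ofFn x).flatten.Nodup)
  (hx : ∀ e, e ∈ (List.ofFn x).flatten ↔ e.1 < e.2 ∧ (gadgetGraph n t ht p q r).Adj e.1 e.2)

theorem mem_flatten_ofFn {β : Type*} {f : Fin M → List β} {b : β} :
    b ∈ (List.ofFn f).flatten ↔ ∃ i, b ∈ f i := by
  simp [List.mem_flatten, List.mem_ofFn]

-- Edge words are injective and only edges of the graph are ever sent; conversely, a present edge is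
-- stored on some machine, which routes it to machine `e / s`.
include hx in
theorem exists_mem_deliver {i : Fin M} {w : Fin n × Fin n} {e : ℕ}
    (he : e < t * t) (hc : IsCoreEdge t e w.1 w.2) (hi : e / s = i) (hlt : w.1 < w.2) :
    (∃ m ∈ deliver (routed t s x) i, m.2 = edgeWord w) ↔ gadgetRel t p q r w.1 w.2 := by
  have hx' : ∀ j, ∀ e ∈ x j, e.1 < e.2 ∧ (gadgetGraph n t ht p q r).Adj e.1 e.2 := fun j e he =>
    (hx e).mp (mem_flatten_ofFn.mpr ⟨j, he⟩)
  constructor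
  · rintro ⟨m, hm, hmw⟩
    obtain ⟨j, -, hj⟩ := mem_deliver.mp hm
    obtain ⟨w', hw', e', he', hc', h⟩ := (mem_routed (hx' j)).mp hj
    have h2 := (congrArg Prod.snd h).symm.trans hmw
    rw [← edgeWord_injective h2]
    exact (gadgetGraph_adj_of_lt (hx' j w' hw').1).mp (hx' j w' hw').2
  · intro h
    obtain ⟨j, hj⟩ := mem_flatten_ofFn.mp ((hx w).mpr ⟨hlt, Or.inl h⟩)
    exact ⟨(j, edgeWord w), mem_deliver.mpr ⟨j, rfl,
      (mem_routed (hx' j)).mpr ⟨w, hj, e, he, hc, by rw [hi]⟩⟩, rfl⟩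

include hnodup hx in
/-- No machine receives more than three words for each of its potential triangles. -/
theorem length_deliver_le (hs : 0 < s) (i : Fin M) :
    (deliver (routed t s x) i).length ≤ 3 * s := by
  classical
  let B := 2 ^ Nat.size n
  let f₁ : ℕ → ℕ := fun k => (t + 1 + k / t) * B + (2 * t + 1 + k % t)
  let f₂ : ℕ → ℕ := fun k => (t + 1 + k / t) * B + (3 * t + 1 + k)
  let f₃ : ℕ → ℕ := fun k => (2 * t + 1 + k % t) * B + (3 * t + 1 + k)
  let S := Finset.Ico (i * s) (i * s + s)
  -- Machine `i` is in charge of the `s` numbers in `S`, and every arriving word is one of the three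
  -- edge words of such a number.
  have hsub : ((deliver (routed t s x) i).map Prod.snd).toFinset ⊆
      S.image f₁ ∪ S.image f₂ ∪ S.image f₃ := by
    intro b hb
    obtain ⟨m, hm, rfl⟩ := List.mem_map.mp (List.mem_toFinset.mp hb)
    obtain ⟨j, -, hj⟩ := mem_deliver.mp hm
    obtain ⟨w, hw, e, he, hc, h⟩ := (mem_routed fun e he =>
      (hx e).mp (mem_flatten_ofFn.mpr ⟨j, he⟩)).mp hj
    obtain ⟨h1, h2⟩ := Prod.mk.inj h
    have heS : e ∈ S := by
      have h3 := Nat.div_add_mod' e s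
      have h4 := Nat.mod_lt e hs
      rw [← h1] at h3
      rw [Finset.mem_Ico]
      omega
    rw [h2, edgeWord]
    simp only [Finset.mem_union, Finset.mem_image]
    rcases hc with ⟨hu, hv⟩ | ⟨hu, hv⟩ | ⟨hu, hv⟩ <;> rw [hu, hv]
    · exact Or.inl (Or.inl ⟨e, heS, rfl⟩)
    · exact Or.inl (Or.inr ⟨e, heS, rfl⟩)
    · exact Or.inr ⟨e, heS, rfl⟩
  have hcard := Finset.card_le_card hsub
  rw [List.toFinset_card_of_nodup (deliver_map_snd_nodup hnodup i), List.length_map] at hcard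
  have hS : S.card = s := by simp [S]
  have h1 := Finset.card_image_le (s := S) (f := f₁)
  have h2 := Finset.card_image_le (s := S) (f := f₂)
  have h3 := Finset.card_image_le (s := S) (f := f₃)
  have h4 := Finset.card_union_le (S.image f₁ ∪ S.image f₂) (S.image f₃)
  have h5 := Finset.card_union_le (S.image f₁) (S.image f₂)
  omega

include hx in
theorem reportTriangle_eq_some (hn : 3 * t + 1 + t * t + (t + 1) * (t + 1) ≤ n)
    {i : Fin M} {e : ℕ} (hi : e / s = i) {y : OutItem} :
    reportTriangle (2 ^ Nat.size n) t (deliver (routed t s x) i) e = some y ↔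
      y = potentialTriangle t e ∧ e < t * t ∧ p e ∧ q e ∧ r e := by
  rw [reportTriangle]
  by_cases he : e < t * t
  · obtain ⟨k, hk, j, hj, hkj⟩ := exists_pair he
    have hxlt : t + 1 + e / t < n := by rw [hkj, pair_div hj]; omega
    have hylt : 2 * t + 1 + e % t < n := by rw [hkj, pair_mod hj]; omega
    have hzlt : 3 * t + 1 + e < n := by omega
    have hkt : e / t < t := by rw [hkj, pair_div hj]; exact hk
    have hjt : e % t < t := by rw [hkj, pair_mod hj]; exact hj
    have e1 := exists_mem_deliver hx (i := i) (w := (⟨_, hxlt⟩, ⟨_, hylt⟩)) he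
      (Or.inl ⟨rfl, rfl⟩) hi (Fin.mk_lt_mk.mpr (by omega))
    have e2 := exists_mem_deliver hx (i := i) (w := (⟨_, hxlt⟩, ⟨_, hzlt⟩)) he
      (Or.inr (Or.inl ⟨rfl, rfl⟩)) hi (Fin.mk_lt_mk.mpr (by omega))
    have e3 := exists_mem_deliver hx (i := i) (w := (⟨_, hylt⟩, ⟨_, hzlt⟩)) he
      (Or.inr (Or.inr ⟨rfl, rfl⟩)) hi (Fin.mk_lt_mk.mpr (by omega))
    simp only [edgeWord] at e1 e2 e3
    have hcond := and_congr e1 (and_congr e2 e3)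
    subst hkj
    simp only [pair_div hj, pair_mod hj] at hcond ⊢
    rw [gadgetRel_xy ht hk hj, gadgetRel_xz ht hk hj, gadgetRel_yz ht hk hj] at hcond
    by_cases hpqr : p (k * t + j) ∧ q (k * t + j) ∧ r (k * t + j)
    · rw [if_pos ⟨he, hcond.mpr hpqr⟩, Option.some.injEq]
      exact ⟨fun h => ⟨h.symm, he, hpqr⟩, fun h => h.1.symm⟩
    · rw [if_neg fun h => hpqr (hcond.mp h.2)]
      exact ⟨fun h => by simp at h, fun h => absurd h.2.2 hpqr⟩
  · rw [if_neg fun h => he h.1]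
    exact ⟨fun h => by simp at h, fun h => absurd h.2.1 he⟩

/-- What machine `i` reports. -/
def reported (t s : ℕ) (x : Fin M → List (Fin n × Fin n)) (i : Fin M) : List OutItem :=
  (List.range s).filterMap fun k =>
    reportTriangle (2 ^ Nat.size n) t (deliver (routed t s x) i) (i * s + k)

include hx in
theorem mem_reported (hn : 3 * t + 1 + t * t + (t + 1) * (t + 1) ≤ n) (hs : 0 < s) {i : Fin M}
    {y : OutItem} : y ∈ reported t s x i ↔
      ∃ e < t * t, e / s = i ∧ y = potentialTriangle t e ∧ p e ∧ q e ∧ r e := by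
  have hdiv : ∀ k < s, ((i : ℕ) * s + k) / s = i := fun k hk => pair_div hk
  simp only [reported, List.mem_filterMap, List.mem_range]
  constructor
  · rintro ⟨k, hk, h⟩
    obtain ⟨rfl, he, h⟩ := (reportTriangle_eq_some hx hn (hdiv k hk)).mp h
    exact ⟨_, he, hdiv k hk, rfl, h⟩
  · rintro ⟨e, he, hi, rfl, h⟩
    have hmod := Nat.mod_lt e hs
    have hdm := Nat.div_add_mod' e s
    rw [hi] at hdm
    refine ⟨e % s, hmod, ?_⟩
    rw [hdm]
    exact (reportTriangle_eq_some hx hn hi).mpr ⟨rfl, he, h⟩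

-- Different machines are in charge of disjoint ranges of numbers, and different numbers give
-- different triangles. This controls the total length of the output.
include hx in
theorem flatMap_reported_nodup (hn : 3 * t + 1 + t * t + (t + 1) * (t + 1) ≤ n) (hs : 0 < s) :
    ((List.finRange M).flatMap (reported t s x)).Nodup := by
  rw [List.nodup_flatMap]
  refine ⟨fun i _ => ?_, (List.nodup_finRange M).pairwise_of_forall_ne fun i _ j _ hij y hi hj => ?_⟩
  · have hdiv : ∀ k < s, ((i : ℕ) * s + k) / s = i := fun k hk => pair_div hk
    have hinj : ∀ l : List ℕ, l.Nodup → (∀ k ∈ l, k < s) → (l.filterMap fun k =>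
        reportTriangle (2 ^ Nat.size n) t (deliver (routed t s x) i) (i * s + k)).Nodup := by
      intro l
      induction l with
      | nil => simp
      | cons k l ih =>
        intro hl hks
        rw [List.nodup_cons] at hl
        have hih := ih hl.2 fun k' hk' => hks k' (List.mem_cons_of_mem _ hk')
        rw [List.filterMap_cons]
        split
        · exact hih
        · rename_i y hy
          refine List.nodup_cons.mpr ⟨fun hmem => ?_, hih⟩
          obtain ⟨k', hk', hy'⟩ := List.mem_filterMap.mp hmem
          have h1 := ((reportTriangle_eq_some hx hn
            (hdiv k (hks k List.mem_cons_self))).mp hy).1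
          have h2 := ((reportTriangle_eq_some hx hn
            (hdiv k' (hks k' (List.mem_cons_of_mem _ hk')))).mp hy').1
          have h3 := potentialTriangle_injective t (h1.symm.trans h2)
          exact hl.1 (by rwa [Nat.add_left_cancel h3])
    exact hinj _ List.nodup_range fun k hk => List.mem_range.mp hk
  · obtain ⟨e, -, he, hy, -⟩ := (mem_reported hx hn hs).mp hi
    obtain ⟨e', -, he', hy', -⟩ := (mem_reported hx hn hs).mp hj
    have := potentialTriangle_injective t (hy.symm.trans hy')
    subst this
    exact hij (Fin.ext (he.symm.trans he'))

end Correctness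

/-- The blocks fit if `(t + 1) ^ 3 + 3 * t ^ 2 ≤ n`. Then the hard graphs have at most `2 * n` edges,
so that their edges fit into the memory of machines with `2 * n ≤ M * S`. -/
theorem blocks_le {t n : ℕ} (ht : 2 ≤ t) (h : (t + 1) ^ 3 + 3 * t ^ 2 ≤ n) :
    3 * t + 1 + t * t + (t + 1) * (t + 1) ≤ n := by
  nlinarith [Nat.zero_le (t ^ 3)]

/-- The program lists the triangles of the hard graphs in one round. -/
theorem triangleProgram_solves {κ : ℕ} {hκ : 2 ≤ κ} {M S a : ℕ → ℕ}
    {𝒢 : (n : ℕ) → Set (SimpleGraph (Fin n))}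
    (h𝒢 : ∀ n, ∀ G ∈ 𝒢 n, ∃ (t : ℕ) (ht : 2 ≤ t) (p q r : ℕ → Prop), a n = t + 1 ∧ 3 ≤ S n ∧
      (t + 1) ^ 3 + 3 * t ^ 2 ≤ n ∧ t * t ≤ M n * (S n / 3) ∧
      G = gadgetGraph n t ht p q r) :
    triangleProgram.Solves (triangleListing κ hκ 𝒢) M S a fun _ => 1 := by
  classical
  -- Factor 1 suffices for the output length, as no triangle is reported twice.
  refine ⟨1, fun n I hI x hrep => ?_⟩
  obtain ⟨t, ht, p, q, r, ha, hS, hn', hM, hG⟩ := h𝒢 n _ hI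
  have hn := blocks_le ht hn'
  obtain ⟨hnodup, hx, hlen⟩ := hrep
  rw [hG] at hx
  intro step init out
  set s := S n / 3 with hs_def
  have hs : 0 < s := by omega
  have h3s : 3 * s ≤ S n := by omega
  have hinit : ∀ i, init i = (x i).map edgeWord := fun i => flatMap_edgeRecord_unlabeled I (x i)
  have hsent : sentInRound step init 0 = routed t s x := by
    funext i
    show (init i).filterMap (routeEdge (idBase n) (a n - 1) s) = _
    rw [hinit, idBase_eq, ha, Nat.add_sub_cancel]
    rfl
  have hrun : ∀ i, runNetwork step init 1 i = ([], deliver (routed t s x) i) := by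
    intro i
    refine Prod.ext rfl ?_
    rw [runNetwork_succ_snd, hsent]
  have hout : ∀ i, out i = reported t s x i := by
    intro i
    show (List.range s).filterMap (fun k => reportTriangle (idBase n) (a n - 1)
      (runNetwork step init 1 i).2 (i * s + k)) = _
    rw [hrun, idBase_eq, ha, Nat.add_sub_cancel]
    rfl
  have hlength : ∀ i, ∀ y ∈ reported t s x i, y.length = 3 := by
    intro i y hy
    obtain ⟨e, -, -, rfl, -⟩ := (mem_reported hx hn hs).mp hy
    rfl
  have hsum : ∀ l : List OutItem, (∀ y ∈ l, y.length = 3) →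
      (l.map List.length).sum = 3 * l.length := by
    intro l hl
    rw [List.map_congr_left hl, List.map_const', List.sum_replicate, smul_eq_mul, mul_comm]
  refine ⟨fun k (hk : k ≤ 1) i => ?_, fun k (hk : k < 1) i => ?_, fun i => ?_, ?_⟩
  · obtain rfl | rfl : k = 0 ∨ k = 1 := by omega
    · refine ⟨hlen i, fun w hw => ?_⟩
      have hw' : w ∈ init i := hw
      rw [hinit] at hw'
      obtain ⟨e, -, rfl⟩ := List.mem_map.mp hw'
      exact edgeWord_lt hκ e
    · rw [hrun]
      refine ⟨?_, fun w hw => by simp at hw⟩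
      rw [List.length_nil, zero_add]
      exact (length_deliver_le hnodup hx hs i).trans h3s
  · obtain rfl : k = 0 := by omega
    rw [hsent]
    constructor
    · refine (List.length_filterMap_le _ _).trans ?_
      rw [← hinit]
      exact hlen i
    · intro m hm
      obtain ⟨w, -, e, he, -, rfl⟩ := (mem_routed fun e he =>
        (hx e).mp (mem_flatten_ofFn.mpr ⟨i, he⟩)).mp hm
      exact ⟨(Nat.div_lt_iff_lt_mul hs).mpr (he.trans_le hM), edgeWord_lt hκ w⟩
  · rw [hout, hsum _ (hlength i)]
    refine le_trans (Nat.mul_le_mul_left 3 ?_) h3s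
    exact (List.length_filterMap_le _ _).trans (by simp)
  · have hmem : ∀ y, y ∈ triangleItems I.graph ↔ ∃ i, y ∈ reported t s x i := by
      intro y
      rw [hG, mem_triangleItems_gadgetGraph hn]
      simp only [mem_reported hx hn hs]
      constructor
      · rintro ⟨e, he, hy, h⟩
        exact ⟨⟨e / s, (Nat.div_lt_iff_lt_mul hs).mpr (he.trans_le hM)⟩, e, he, rfl, hy, h⟩
      · rintro ⟨i, e, he, -, hy, h⟩
        exact ⟨e, he, hy, h⟩
    refine ⟨triangleItems I.graph, rfl, fun y => ?_, ?_⟩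
    · simp only [hout]
      exact hmem y
    · have h1 : ∑ y ∈ triangleItems I.graph, y.length = (triangleItems I.graph).card * 3 :=
        Finset.sum_const_nat fun y hy => by
          obtain ⟨i, hi⟩ := (hmem y).mp hy
          exact hlength i y hi
      have h2 : ∀ i, ((out i).map List.length).sum = 3 * (reported t s x i).length :=
        fun i => by rw [hout, hsum _ (hlength i)]
      have h3 : ∑ i, (reported t s x i).length
          = ((List.finRange (M n)).flatMap (reported t s x)).length := by
        rw [List.length_flatMap, ← List.ofFn_eq_map, List.sum_ofFn]
      have h4 : ((List.finRange (M n)).flatMap (reported t s x)).length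
          ≤ (triangleItems I.graph).card := by
        rw [← List.toFinset_card_of_nodup (flatMap_reported_nodup hx hn hs)]
        refine Finset.card_le_card fun y hy => ?_
        obtain ⟨i, -, hi⟩ := List.mem_flatMap.mp (List.mem_toFinset.mp hy)
        exact (hmem y).mpr ⟨i, hi⟩
      rw [Finset.sum_congr rfl fun i _ => h2 i, ← Finset.mul_sum, h1, h3]
      omega

/-! ### The main theorem -/

/-- From `2 ^ (Nat.size n - 1) ≤ n` and `log 2 > 1 / 2` follows `Nat.size n ≤ 1 + 2 * log n`, and `n
≥ 3 > e` lets `log n` absorb the 1. -/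
theorem size_le_three_mul_log {n : ℕ} (hn : 3 ≤ n) :
    (Nat.size n : ℝ) ≤ 3 * Real.log n ∧ 1 ≤ Real.log n := by
  have hn' : (3 : ℝ) ≤ n := by exact_mod_cast hn
  have h1 : 1 ≤ Real.log n := by
    rw [Real.le_log_iff_exp_le (by linarith)]
    linarith [Real.exp_one_lt_d9]
  refine ⟨?_, h1⟩
  have hpos : 0 < Nat.size n := Nat.size_pos.mpr (by omega)
  have h2 : 2 ^ (Nat.size n - 1) ≤ n := Nat.lt_size.mp (by omega)
  have h3 : ((Nat.size n - 1 : ℕ) : ℝ) * Real.log 2 ≤ Real.log n := by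
    rw [← Real.log_pow]
    exact Real.log_le_log (by positivity) (by exact_mod_cast h2)
  rw [Nat.cast_sub (by omega), Nat.cast_one] at h3
  have hs : (1 : ℝ) ≤ Nat.size n := by exact_mod_cast hpos
  nlinarith [Real.log_two_gt_d9]

/-- `MPC(M, S)` cannot be simulated in `NCC(MS/n)` with constant slowdown on graphs of arboricity
`a ∈ ω(log n) ∩ o(n^{1/3})`. -/
theorem mainTheorem4 (κ : ℕ) (hκ : 2 ≤ κ) :
    ∃ K c : ℝ, 0 < K ∧ 0 < c ∧
      ∀ a : ℕ → ℕ,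
        (fun n : ℕ => Real.log n) =o[atTop] (fun n : ℕ => (a n : ℝ)) →
        (fun n : ℕ => (a n : ℝ)) =o[atTop] (fun n : ℕ => (n : ℝ) ^ (1 / 3 : ℝ)) →
        ∀ δ : ℝ, 0 < δ → δ < 1 →
        ∀ M S : ℕ → ℕ,
          (∀ᶠ n : ℕ in atTop, (n : ℝ) ^ δ ≤ S n) →
          (∀ᶠ n : ℕ in atTop, 2 * n ≤ M n * S n) →
          (fun n : ℕ => (M n * S n : ℝ) / n * Real.log n) =o[atTop]
            (fun n : ℕ => (a n : ℝ)) →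
          ¬ MPCDominatedByNCC (problemsOfArboricity κ a) M S a
              (fun n => ⌈(M n * S n : ℝ) / n⌉₊) ∧
          ∃ 𝒢 : (n : ℕ) → Set (SimpleGraph (Fin n)),
            (∀ n, ∀ G ∈ 𝒢 n, G.Connected ∧ arboricity G = a n) ∧
            (∃ T : ℕ, (T : ℝ) ≤ K / δ ∧
              SolvableInMPC (triangleListing κ hκ 𝒢) M S a (fun _ => T)) ∧
            (∀ᶠ n : ℕ in atTop, ∀ (C T β : ℕ)
              (A : NCCAlgorithm n (triangleListing κ hκ 𝒢).labelWords),
              A.Solves (triangleListing κ hκ 𝒢) C T β →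
                c * a n ≤ C * T * Real.log n) := by
  -- `192 = 2 * 96`, where the 2 comes from `a n = t + 1 ≤ 2 * t`; and `((κ + 1) * Nat.size n + 1) ≤
  -- (3 * κ + 4) * log n`.
  set c : ℝ := 1 / (192 * (3 * κ + 4)) with hc_def
  have hc : 0 < c := by positivity
  refine ⟨1, c, one_pos, hc, ?_⟩
  intro a hlog hcube δ hδ hδ1 M S hS hMS hMSa
  -- The size conditions are part of the class: it is empty wherever they fail, so the program is
  -- correct for all `n`, although the hypotheses on `a`, `M`, `S` are only asymptotic.
  let 𝒢 : (n : ℕ) → Set (SimpleGraph (Fin n)) := fun n =>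
    {G | ∃ (t : ℕ) (ht : 2 ≤ t) (p q r : ℕ → Prop), a n = t + 1 ∧ 3 ≤ S n ∧
      (t + 1) ^ 3 + 3 * t ^ 2 ≤ n ∧ t * t ≤ M n * (S n / 3) ∧
      G = gadgetGraph n t ht p q r}
  have h𝒢 : ∀ n, ∀ G ∈ 𝒢 n, G.Connected ∧ arboricity G = a n := by
    rintro n _ ⟨t, ht, p, q, r, ha, -, hn, -, rfl⟩
    exact ⟨gadgetGraph_connected (blocks_le ht hn),
      (gadgetGraph_arboricity (blocks_le ht hn)).trans ha.symm⟩
  have hMPC : SolvableInMPC (triangleListing κ hκ 𝒢) M S a fun _ => 1 :=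
    ⟨triangleProgram, triangleProgram_solves fun n G hG => hG⟩
  have hlogtop : Tendsto (fun n : ℕ => Real.log n) atTop atTop :=
    Real.tendsto_log_atTop.comp tendsto_natCast_atTop_atTop
  have hNCC : ∀ᶠ n : ℕ in atTop, ∀ (C T β : ℕ)
      (A : NCCAlgorithm n (triangleListing κ hκ 𝒢).labelWords),
      A.Solves (triangleListing κ hκ 𝒢) C T β → c * a n ≤ C * T * Real.log n := by
    have hSlarge : ∀ᶠ n : ℕ in atTop, (3 : ℝ) ≤ (n : ℝ) ^ δ :=
      ((tendsto_rpow_atTop hδ).comp tendsto_natCast_atTop_atTop).eventually_ge_atTop 3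
    filter_upwards [hS, hMS, hSlarge, hlog.bound one_pos, hcube.bound (half_pos one_pos),
      hlogtop.eventually_ge_atTop 5, eventually_ge_atTop 3] with n hSn hMSn hSl hla hac hl5 hn3
    intro C T β A hA
    have ha5 : 5 ≤ a n := by
      have h1 : (5 : ℝ) ≤ a n := by
        rw [one_mul, Real.norm_of_nonneg (by linarith), Real.norm_of_nonneg (by positivity)] at hla
        linarith
      exact_mod_cast h1
    have ha3 : 2 * a n ^ 3 ≤ n := by
      rw [Real.norm_of_nonneg (by positivity), Real.norm_of_nonneg (by positivity)] at hac
      have h1 : (2 * a n : ℝ) ^ 3 ≤ ((n : ℝ) ^ (1 / 3 : ℝ)) ^ 3 :=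
        pow_le_pow_left₀ (by positivity) (by linarith) 3
      rw [← Real.rpow_natCast ((n : ℝ) ^ (1 / 3 : ℝ)), ← Real.rpow_mul (by positivity)] at h1
      norm_num at h1
      have h2 : (2 * a n) ^ 3 ≤ n := by exact_mod_cast h1
      rw [mul_pow] at h2
      omega
    have hS3 : 3 ≤ S n := by
      have h1 : (3 : ℝ) ≤ S n := hSl.trans hSn
      exact_mod_cast h1
    obtain ⟨t, hat⟩ : ∃ t, a n = t + 1 := ⟨a n - 1, by omega⟩
    have ht : 2 ≤ t := by omega
    have hn : (t + 1) ^ 3 + 3 * t ^ 2 ≤ n := by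
      rw [hat] at ha3
      nlinarith [Nat.zero_le (t ^ 3)]
    -- Since `S n ≥ 3`, rounding costs at most a factor 2, so the machines have room for `M n * S n
    -- / 6 ≥ n / 3` triangles; the term `3 * t ^ 2` in `hn` makes this at least `t ^ 2`.
    have hM : t * t ≤ M n * (S n / 3) := by
      have h1 : M n * S n ≤ M n * (6 * (S n / 3)) := Nat.mul_le_mul_left _ (by omega)
      have h2 : M n * (6 * (S n / 3)) = 6 * (M n * (S n / 3)) := by ring
      have h3 : t ^ 2 = t * t := sq t
      omega
    have hmain := hA.gadget_le (ht := ht) (𝒢 := 𝒢) (blocks_le ht hn) fun p q r =>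
      ⟨t, ht, p, q, r, hat, hS3, hn, hM, rfl⟩
    obtain ⟨hsize, hlog1⟩ := size_le_three_mul_log hn3
    have hmain' : (t : ℝ) ≤ 96 * (((κ + 1) * Nat.size n + 1) * C * T) := by exact_mod_cast hmain
    have hat' : (a n : ℝ) ≤ 2 * t := by
      have : a n ≤ 2 * t := by omega
      exact_mod_cast this
    have h1 : ((κ : ℝ) + 1) * Nat.size n + 1 ≤ (3 * κ + 4) * Real.log n := by
      have : ((κ : ℝ) + 1) * Nat.size n ≤ (κ + 1) * (3 * Real.log n) :=
        mul_le_mul_of_nonneg_left hsize (by positivity)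
      linarith
    have h2 : (a n : ℝ) ≤ (192 * (3 * κ + 4)) * (C * T * Real.log n) := by
      calc (a n : ℝ) ≤ 2 * (96 * (((κ + 1) * Nat.size n + 1) * C * T)) := by linarith
        _ ≤ 2 * (96 * (((3 * κ + 4) * Real.log n) * C * T)) := by gcongr
        _ = _ := by ring
    rw [hc_def, one_div, inv_mul_le_iff₀ (by positivity)]
    exact h2
  refine ⟨fun hdom => ?_, 𝒢, h𝒢, ⟨1, ?_, hMPC⟩, hNCC⟩
  · obtain ⟨K, T', hT', A, β, hA⟩ := hdom (triangleListing κ hκ 𝒢)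
      (fun n I hI => (h𝒢 n _ hI).2) (fun _ => 1) (fun _ => le_rfl) hMPC
    -- Chosen so that `2 * K * ε < c`, also for `K = 0`; the 2 is the loss from rounding the
    -- capacity up, which needs `ρ ≥ 1`.
    have hε : 0 < c / (4 * K + 4) := by positivity
    obtain ⟨n, hn, hMSn, hlow, hbound, hla, hl1⟩ := ((eventually_ge_atTop 3).and
      (hMS.and (hNCC.and ((hMSa.bound hε).and ((hlog.bound one_pos).and
        (hlogtop.eventually_ge_atTop 1)))))).exists
    have h1 := hlow _ _ β (A n) (hA n)
    have hn0 : (0 : ℝ) < n := by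
      have : 0 < n := by omega
      exact_mod_cast this
    set ρ : ℝ := (M n * S n : ℝ) / n with hρ_def
    have hρ : 2 ≤ ρ := by
      rw [hρ_def, le_div_iff₀ hn0]
      exact_mod_cast hMSn
    have hceil : (⌈ρ⌉₊ : ℝ) ≤ 2 * ρ := by
      have := Nat.ceil_lt_add_one (a := ρ) (by linarith)
      linarith
    have hT : (T' n : ℝ) ≤ K := by
      have := hT' n
      rw [mul_one] at this
      exact_mod_cast this
    have ha : (0 : ℝ) < a n := by
      rw [one_mul, Real.norm_of_nonneg (by linarith), Real.norm_of_nonneg (by positivity)] at hla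
      linarith
    have hb : ρ * Real.log n ≤ c / (4 * K + 4) * a n := by
      rwa [Real.norm_of_nonneg (mul_nonneg (by linarith) (by linarith)),
        Real.norm_of_nonneg ha.le] at hbound
    have h2 : c * a n ≤ 2 * K * (c / (4 * K + 4) * a n) := by
      calc c * a n ≤ ⌈ρ⌉₊ * T' n * Real.log n := h1
        _ ≤ (2 * ρ) * K * Real.log n := by gcongr
        _ = 2 * K * (ρ * Real.log n) := by ring
        _ ≤ _ := by gcongr
    have h3 : 2 * K * (c / (4 * K + 4) * a n) < c * a n := by
      have hK : (0 : ℝ) < 4 * K + 4 := by positivity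
      have : 2 * K * (c / (4 * K + 4) * a n) = (c * a n) * (2 * K / (4 * K + 4)) := by
        field_simp
      rw [this]
      refine mul_lt_of_lt_one_right (mul_pos hc ha) ?_
      rw [div_lt_one hK]
      have : (0 : ℝ) ≤ K := by positivity
      linarith
    linarith
  · rw [Nat.cast_one, le_div_iff₀ hδ]
    linarith
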